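/- Let $P$ be a finite partially ordered set. The order polytope $\mathcal{O}(P)\subset\mathbb{R}^P$ is the set of all $x$ with $0\le x_p\le 1$ for all $p\in P$ and $x_p\ge x_q$ whenever $p\le q$; the chain polytope $\mathcal{C}(P)\subset\mathbb{R}^P$ is the set of all $x$ with $x_p\ge 0$ for all $p\in P$ and $x_{p_1}+\cdots+x_{p_k}\le 1$ for every chain $p_1<\cdots<p_k$ in $P$. The poset $P$ is called graded if all its maximal chains have the same length; the rank of an element of a graded poset is the maximal length of a chain ending at it, and a graded poset $P$ is called a maximal ranked poset if any two elements of distinct rank are comparable. We say that $P$ contains an $X$-poset as a subposet if there are $a,b,c,d,e\in P$ such that $a<c$, $b<c$, $c<d$, $c<e$, the elements $a,b$ are incomparable, and the elements $d,e$ are incomparable. A triangular $2$-face of a polytope is a face of it (the polytope itself being allowed) that is a triangle, that is, the convex hull of three affinely independent points. Theorem. Let $P$ be a maximal ranked poset. Then the number of triangular $2$-faces of $\mathcal{O}(P)$ is equal to the number of triangular $2$-faces of $\mathcal{C}(P)$ if and only if $P$ does not contain an $X$-poset as a subposet. Moreover, if $P$ contains an $X$-poset as a subposet, then $\mathcal{C}(P)$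 has strictly more triangular $2$-faces than $\mathcal{O}(P)$. -/

import Mathlib

/-- A finite poset is graded if all its maximal chains have the same length (equivalently, the same
number of elements). -/
def IsGradedPoset (P : Type*) [PartialOrder P] : Prop :=
  ∀ s t : Set P, IsMaxChain (· ≤ ·) s → IsMaxChain (· ≤ ·) t → s.ncard = t.ncard

/-- A maximal ranked poset: a graded poset in which any two elements of distinct rank are
comparable. The rank of an element is the maximal length of a chain ending at it, which is
`Order.height`. -/
def IsMaximalRanked (P : Type*) [PartialOrder P] : Prop :=
  IsGradedPoset P ∧ ∀ x y : P, Order.height x ≠ Order.height y → x ≤ y ∨ y ≤ x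

/-- `P` contains an X-poset as a subposet: there are `a, b < c < d, e` with `a, b` incomparable
and `d, e` incomparable (so the five elements are pairwise distinct). -/
def ContainsXPoset (P : Type*) [PartialOrder P] : Prop :=
  ∃ a b c d e : P, a < c ∧ b < c ∧ c < d ∧ c < e ∧
    (¬ a ≤ b ∧ ¬ b ≤ a) ∧ (¬ d ≤ e ∧ ¬ e ≤ d)

/-- The order polytope of `P`, in the space with one coordinate for each element of `P`. -/
def orderPolytope (P : Type*) [PartialOrder P] : Set (P → ℝ) :=
  {x | (∀ p, 0 ≤ x p ∧ x p ≤ 1) ∧ ∀ p q, p ≤ q → x q ≤ x p}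

/-- The chain polytope of `P`, in the space with one coordinate for each element of `P`. -/
def chainPolytope (P : Type*) [PartialOrder P] : Set (P → ℝ) :=
  {x | (∀ p, 0 ≤ x p) ∧
    ∀ s : Finset P, IsChain (· ≤ ·) (s : Set P) → ∑ p ∈ s, x p ≤ 1}

/-- The triangular 2-faces of a convex polytope `A`: the faces (sets where a linear functional is
maximal on `A`, with `A` itself allowed) that are triangles, that is, convex hulls of three
affinely independent points. -/
def triangularFaces {P : Type*} (A : Set (P → ℝ)) : Set (Set (P → ℝ)) :=
  {F | IsExposed ℝ A F ∧
    ∃ T : Affine.Triangle ℝ (P → ℝ), F = convexHull ℝ (Set.range T.points)}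

/-! A maximal ranked poset is an ordinal sum of antichains, its levels: with `r` the height, `p < q`
holds exactly when `r p < r q`. The vertices of the order polytope are the indicator vectors of
ideals (lower sets), those of the chain polytope the indicator vectors of antichains, that is, of
the empty set and of the nonempty subsets of single levels. By `encard_triangularFaces`, triangular
faces correspond to exposed families of three vertices, so both counts become combinatorial.

In each polytope, three vertices are ruled out by exchange: if two of them have the same indicator
sum as two other vertices, these lie on the face too. Conversely, enough valid inequalities are
found that are tight on the three vertices and jointly exclude every other one. For the order
polytope this leaves chains of ideals `I ⊂ J ⊂ K` for which `J \ I`, `K \ J` and `K \ I` are all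
connected. Recording the boundary levels of the three ideals gives triples `(X, W, Z)` of level
subsets (`IsOrderTriple`). For the chain polytope, two vertices may lie together if they are
nonempty on different levels, or differ in one element; this gives `IsChainTriple`.

The two kinds of triples almost coincide. Those found only on the order side have as `W` the full
level of `X`, with `X` a singleton. Those found only on the chain side have either `W = ∅` with `X`
and `Z` singletons, or as `W` the full level just below `Z`, with `Z` not a singleton. The map
`comparison` fixes the common triples and sends the first sort injectively into the second. What it
misses are the triples with full level just below `Z` in which neither `X` nor `Z` is a singleton.
Such `X` and `Z`, with a level strictly between them, are exactly an X-poset. -/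

/-! ### Faces of polytopes with 0/1 vertices -/

/-- The `0/1` indicator vector of a finite set. -/
noncomputable def indVec {P : Type*} (v : Finset P) : P → ℝ := (v : Set P).indicator 1

/-- `T` is the set of members of `V` at which some linear functional is maximal on `V`, where finite
sets are identified with their indicator vectors. -/
def IsFaceFamily {P : Type*} (V : Set (Finset P)) (T : Finset (Finset P)) : Prop :=
  (T : Set (Finset P)) ⊆ V ∧ ∃ (w : P → ℝ) (c : ℝ), ∀ v ∈ V,
    ∑ p ∈ v, w p ≤ c ∧ (∑ p ∈ v, w p = c ↔ v ∈ T)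

theorem indVec_apply {P : Type*} [DecidableEq P] (v : Finset P) (p : P) :
    indVec v p = if p ∈ v then 1 else 0 := by
  simp [indVec, Set.indicator_apply]

theorem indVec_injective {P : Type*} : Function.Injective (indVec (P := P)) := by
  classical
  intro u v h
  ext p
  have := congrFun h p
  simp only [indVec_apply] at this
  split_ifs at this <;> simp_all

/-- A 0/1 vector is already extreme in the unit cube, which contains the hull. -/
theorem indVec_mem_extremePoints {P : Type*} {S : Set (Finset P)} {v : Finset P}
    (hv : indVec v ∈ convexHull ℝ (indVec '' S)) :
    indVec v ∈ (convexHull ℝ (indVec '' S)).extremePoints ℝ := by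
  classical
  have hcube : convexHull ℝ (indVec '' S) ⊆ Set.univ.pi fun _ : P => Set.Icc (0 : ℝ) 1 := by
    refine convexHull_min ?_ (convex_pi fun _ _ => convex_Icc 0 1)
    rintro _ ⟨u, -, rfl⟩ p -
    simp only [indVec_apply]
    split_ifs <;> simp
  refine inter_extremePoints_subset_extremePoints_of_subset hcube ⟨hv, ?_⟩
  rw [extremePoints_pi]
  intro p _
  rw [Set.extremePoints_Icc zero_le_one, indVec_apply]
  split_ifs <;> simp

theorem indVec_mem_convexHull {P : Type*} {S : Set (Finset P)} {v : Finset P} :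
    indVec v ∈ convexHull ℝ (indVec '' S) ↔ v ∈ S := by
  refine ⟨fun h => ?_, fun h => subset_convexHull ℝ _ ⟨v, h, rfl⟩⟩
  obtain ⟨u, hu, e⟩ := extremePoints_convexHull_subset (indVec_mem_extremePoints h)
  exact indVec_injective e ▸ hu

theorem sum_mul_indVec {P : Type*} [Fintype P] (w : P → ℝ) (v : Finset P) :
    ∑ p, w p * indVec v p = ∑ p ∈ v, w p := by
  classical
  simp [indVec_apply]

theorem continuousLinearMap_indVec {P : Type*} [Finite P] [DecidableEq P] (l : StrongDual ℝ (P → ℝ))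
    (v : Finset P) : l (indVec v) = ∑ p ∈ v, l (Pi.single p 1) := by
  rw [← map_sum]
  congr 1
  ext q
  simp [indVec_apply, Finset.sum_apply, Pi.single_apply]

/-- A linear functional which on a generating set `S` is at most `c`, with equality exactly on
`S'`, exposes the convex hull of `S'`. -/
theorem convexHull_eq_setOf_forall_le {E : Type*} [AddCommGroup E] [Module ℝ E]
    [TopologicalSpace E] {S S' : Set E} (l : StrongDual ℝ E) (c : ℝ) (hS' : S' ⊆ S)
    (hne : S'.Nonempty) (hle : ∀ x ∈ S, l x ≤ c) (heq : ∀ x ∈ S, l x = c ↔ x ∈ S') :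
    convexHull ℝ S' = {x ∈ convexHull ℝ S | ∀ y ∈ convexHull ℝ S, l y ≤ l x} := by
  have hall : ∀ x ∈ convexHull ℝ S, l x ≤ c := fun x hx =>
    convexHull_min (t := {x | l x ≤ c}) hle (convex_halfSpace_le l.isLinear c) hx
  have hon : ∀ x ∈ convexHull ℝ S', l x = c := fun x hx =>
    convexHull_min (t := {x | l x = c}) (fun y hy => (heq y (hS' hy)).2 hy)
      (convex_hyperplane l.isLinear c) hx
  ext x
  constructor
  · exact fun hx => ⟨convexHull_mono hS' hx, fun y hy => (hall y hy).trans (hon x hx).ge⟩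
  · rintro ⟨hx, hmax⟩
    obtain ⟨z, hz⟩ := hne
    have hlx : c ≤ l x := ((heq z (hS' hz)).2 hz).ge.trans (hmax z (subset_convexHull ℝ _ (hS' hz)))
    -- This union is convex because a proper convex combination of points with `l ≤ c`, one of them
    -- strict, is strict. It contains `S`, hence its hull, so a point of the hull with `l = c` lies
    -- in the hull of `S'`.
    have hconv : Convex ℝ ({x | l x < c} ∪ convexHull ℝ S') := by
      rw [convex_iff_forall_pos]
      intro a ha b hb s t hs ht hst
      by_cases h : a ∈ convexHull ℝ S' ∧ b ∈ convexHull ℝ S'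
      · exact Or.inr (convex_convexHull ℝ S' h.1 h.2 hs.le ht.le hst)
      · left
        have ha' : l a ≤ c := ha.elim (fun h => le_of_lt h) fun h => (hon a h).le
        have hb' : l b ≤ c := hb.elim (fun h => le_of_lt h) fun h => (hon b h).le
        have hlt : l a < c ∨ l b < c := by
          rcases ha with ha | ha
          · exact Or.inl ha
          · rcases hb with hb | hb
            · exact Or.inr hb
            · exact absurd ⟨ha, hb⟩ h
        simp only [Set.mem_ofPred_eq, map_add, map_smul, smul_eq_mul]
        have hc : c = s * c + t * c := by rw [← add_mul, hst, one_mul]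
        rw [hc]
        rcases hlt with h | h
        · exact add_lt_add_of_lt_of_le (mul_lt_mul_of_pos_left h hs)
            (mul_le_mul_of_nonneg_left hb' ht.le)
        · exact add_lt_add_of_le_of_lt (mul_le_mul_of_nonneg_left ha' hs.le)
            (mul_lt_mul_of_pos_left h ht)
    have hsub : convexHull ℝ S ⊆ {x | l x < c} ∪ convexHull ℝ S' := by
      refine convexHull_min (fun y hy => ?_) hconv
      rcases (hle y hy).lt_or_eq with h | h
      · exact Or.inl h
      · exact Or.inr (subset_convexHull ℝ _ ((heq y hy).1 h))
    rcases hsub hx with h | h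
    · exact absurd h (not_lt.2 hlx)
    · exact h

theorem IsFaceFamily.isExposed {P : Type*} [Finite P] {V : Set (Finset P)}
    {T : Finset (Finset P)} (h : IsFaceFamily V T) :
    IsExposed ℝ (convexHull ℝ (indVec '' V)) (convexHull ℝ (indVec '' (T : Set (Finset P)))) := by
  cases nonempty_fintype P
  intro hne
  obtain ⟨hTV, w, c, hw⟩ := h
  let l : StrongDual ℝ (P → ℝ) := ∑ p, w p • ContinuousLinearMap.proj p
  have hl : ∀ v, l (indVec v) = ∑ p ∈ v, w p := fun v => by
    rw [← sum_mul_indVec]; simp [l]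
  refine ⟨l, convexHull_eq_setOf_forall_le l c (Set.image_mono hTV) (convexHull_nonempty_iff.1 hne)
    ?_ ?_⟩
  · rintro _ ⟨v, hv, rfl⟩
    exact hl v ▸ (hw v hv).1
  · rintro _ ⟨v, hv, rfl⟩
    rw [hl, (hw v hv).2, indVec_injective.mem_set_image, Finset.mem_coe]

/-- Three distinct 0/1 vectors are never collinear, since none lies on the segment between the other
two. -/
theorem exists_triangle_of_card_eq_three {P : Type*} {T : Finset (Finset P)} (hT : T.card = 3) :
    ∃ t : Affine.Triangle ℝ (P → ℝ),
      convexHull ℝ (indVec '' (T : Set (Finset P))) = convexHull ℝ (Set.range t.points) := by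
  classical
  obtain ⟨a, b, c, hab, hac, hbc, rfl⟩ := Finset.card_eq_three.1 hT
  have key : ∀ u v w : Finset P, Wbtw ℝ (indVec u) (indVec v) (indVec w) → v = u ∨ v = w := by
    intro u v w h
    have h' : indVec v ∈ convexHull ℝ (indVec '' ({u, w} : Set (Finset P))) := by
      rw [Set.image_pair, convexHull_pair]
      exact h.mem_segment
    simpa using indVec_mem_convexHull.1 h'
  have hai : AffineIndependent ℝ ![indVec a, indVec b, indVec c] := by
    rw [affineIndependent_iff_not_collinear_set]
    intro hcol
    rcases hcol.wbtw_or_wbtw_or_wbtw with h | h | h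
    · rcases key _ _ _ h with h | h <;> simp_all
    · rcases key _ _ _ h with h | h <;> simp_all
    · rcases key _ _ _ h with h | h <;> simp_all
  refine ⟨⟨_, hai⟩, ?_⟩
  congr 1
  ext x
  simp [eq_comm]
  tauto

/-- The 0/1 vectors are extreme, hence vertices of the triangle. A missing vertex would lie in the
affine span of the others, against affine independence. -/
theorem range_points_eq_of_convexHull_eq {P : Type*} {T : Set (Finset P)}
    (t : Affine.Triangle ℝ (P → ℝ))
    (h : convexHull ℝ (indVec '' T) = convexHull ℝ (Set.range t.points)) :
    indVec '' T = Set.range t.points := by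
  have hsub : indVec '' T ⊆ Set.range t.points := by
    rintro _ ⟨v, hv, rfl⟩
    have := indVec_mem_extremePoints (indVec_mem_convexHull.2 hv)
    rw [h] at this
    exact extremePoints_convexHull_subset this
  refine hsub.antisymm ?_
  rintro _ ⟨i, rfl⟩
  by_contra hi
  have h1 : indVec '' T ⊆ t.points '' (Set.univ \ {i}) := by
    intro x hx
    obtain ⟨j, rfl⟩ := hsub hx
    refine ⟨j, ⟨trivial, ?_⟩, rfl⟩
    rintro rfl
    exact hi hx
  have h2 : t.points i ∈ convexHull ℝ (indVec '' T) := h ▸ subset_convexHull ℝ _ ⟨i, rfl⟩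
  exact t.independent.notMem_affineSpan_sdiff i Set.univ
    (affineSpan_mono ℝ h1 (convexHull_subset_affineSpan _ h2))

/-- The triangular faces of a polytope with `0/1` vertices correspond to the exposed families of
three vertices. -/
theorem encard_triangularFaces {P : Type*} [Finite P] (V : Set (Finset P)) :
    (triangularFaces (convexHull ℝ (indVec '' V))).encard =
      {T : Finset (Finset P) | T.card = 3 ∧ IsFaceFamily V T}.encard := by
  classical
  cases nonempty_fintype P
  have hinj : Function.Injective fun T : Finset (Finset P) =>
      convexHull ℝ (indVec '' (T : Set (Finset P))) := by
    intro T T' h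
    ext v
    have : indVec v ∈ convexHull ℝ (indVec '' (T : Set (Finset P))) ↔
      indVec v ∈ convexHull ℝ (indVec '' (T' : Set (Finset P))) := iff_of_eq (congrArg (indVec v ∈ ·) h)
    simpa [indVec_mem_convexHull] using this
  rw [← hinj.encard_image]
  congr 1
  ext F
  constructor
  · rintro ⟨hF, t, rfl⟩
    have hne : (convexHull ℝ (Set.range t.points)).Nonempty :=
      convexHull_nonempty_iff.2 (Set.range_nonempty _)
    obtain ⟨l, hl⟩ := hF hne
    obtain ⟨x₀, hx₀⟩ := hne
    let T : Finset (Finset P) := Finset.univ.filter fun v => v ∈ V ∧ l (indVec v) = l x₀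
    have hmax : ∀ y ∈ convexHull ℝ (indVec '' V), l y ≤ l x₀ := by
      rw [hl] at hx₀; exact hx₀.2
    have hx₀mem : x₀ ∈ convexHull ℝ (indVec '' V) := by rw [hl] at hx₀; exact hx₀.1
    have hface : IsFaceFamily V T := by
      refine ⟨fun v hv => (Finset.mem_filter.1 hv).2.1, fun p => l (Pi.single p 1), l x₀,
        fun v hv => ?_⟩
      have hlv : ∑ p ∈ v, l (Pi.single p 1) = l (indVec v) := by
        rw [continuousLinearMap_indVec]
      rw [hlv]
      exact ⟨hmax _ (subset_convexHull ℝ _ ⟨v, hv, rfl⟩), by simp [T, hv]⟩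
    have hTne : (indVec '' (T : Set (Finset P))).Nonempty := by
      by_contra hcon
      rw [Set.not_nonempty_iff_eq_empty] at hcon
      have hsub : convexHull ℝ (indVec '' V) ⊆ {x | l x < l x₀} := by
        refine convexHull_min ?_ (convex_halfSpace_lt l.isLinear _)
        rintro _ ⟨v, hv, rfl⟩
        refine lt_of_le_of_ne (hmax _ (subset_convexHull ℝ _ ⟨v, hv, rfl⟩)) fun h => ?_
        have : indVec v ∈ indVec '' (T : Set (Finset P)) := ⟨v, by simp [T, hv, h], rfl⟩
        rw [hcon] at this
        exact this
      exact lt_irrefl (l x₀) (hsub hx₀mem)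
    have heq : convexHull ℝ (indVec '' (T : Set (Finset P))) =
        convexHull ℝ (Set.range t.points) := by
      rw [hl]
      refine convexHull_eq_setOf_forall_le l (l x₀) (Set.image_mono hface.1) hTne ?_ ?_
      · exact fun x hx => hmax x (subset_convexHull ℝ _ hx)
      · rintro _ ⟨v, hv, rfl⟩
        rw [indVec_injective.mem_set_image]
        simp [T, hv]
    refine ⟨T, ⟨?_, hface⟩, heq⟩
    have hr := range_points_eq_of_convexHull_eq t heq
    have h1 : (indVec '' (T : Set (Finset P))).encard = 3 := by
      rw [hr, ← Set.image_univ, t.independent.injective.encard_image, Set.encard_univ]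
      simp
    rw [indVec_injective.encard_image, Set.encard_coe_eq_coe_finsetCard] at h1
    exact_mod_cast h1
  · rintro ⟨T, ⟨hT, hface⟩, rfl⟩
    exact ⟨hface.isExposed, exists_triangle_of_card_eq_three hT⟩

/-- A compact convex set whose extreme points are `0/1` vectors. -/
theorem eq_convexHull_indVec {P : Type*} [Finite P] {A : Set (P → ℝ)} {V : Set (Finset P)}
    (hc : IsCompact A) (hconv : Convex ℝ A) (hV : ∀ v ∈ V, indVec v ∈ A)
    (hext : A.extremePoints ℝ ⊆ indVec '' V) : A = convexHull ℝ (indVec '' V) := by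
  cases nonempty_fintype P
  refine Set.Subset.antisymm ?_ (convexHull_min (by rintro _ ⟨v, hv, rfl⟩; exact hV v hv) hconv)
  rw [← closure_convexHull_extremePoints hc hconv]
  exact closure_minimal (convexHull_mono hext) ((Set.toFinite _).isClosed_convexHull (𝕜 := ℝ))

/-! ### Criteria for exposed families: separation and exchange -/

/-- A family is a face if each vertex outside it is separated from it by a valid inequality. -/
theorem isFaceFamily_of_separated {P : Type*} [Finite P] {V : Set (Finset P)}
    {T : Finset (Finset P)} (hTV : (T : Set (Finset P)) ⊆ V)
    (h : ∀ v ∈ V, v ∉ T → ∃ (w : P → ℝ) (c : ℝ), (∀ u ∈ V, ∑ p ∈ u, w p ≤ c) ∧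
      (∀ t ∈ T, ∑ p ∈ t, w p = c) ∧ ∑ p ∈ v, w p < c) : IsFaceFamily V T := by
  classical
  cases nonempty_fintype P
  choose! w c h1 h2 h3 using h
  let S : Finset (Finset P) := Finset.univ.filter fun v => v ∈ V ∧ v ∉ T
  have hS : ∀ v, v ∈ S ↔ v ∈ V ∧ v ∉ T := fun v => by simp [S]
  -- The sum of the separating inequalities is tight only where all of them are.
  refine ⟨hTV, fun p => ∑ v ∈ S, w v p, ∑ v ∈ S, c v, fun u hu => ?_⟩
  rw [Finset.sum_comm]
  have hle : ∀ v ∈ S, ∑ p ∈ u, w v p ≤ c v := fun v hv =>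
    h1 v ((hS v).1 hv).1 ((hS v).1 hv).2 u hu
  refine ⟨Finset.sum_le_sum hle, fun he => ?_, fun hut => ?_⟩
  · by_contra hut
    have huS := (hS u).2 ⟨hu, hut⟩
    exact (Finset.sum_lt_sum hle ⟨u, huS, h3 u hu hut⟩).ne he
  · exact Finset.sum_congr rfl fun v hv => h2 v ((hS v).1 hv).1 ((hS v).1 hv).2 u hut

/-- The functional has the same total on `u, v` as on `a, b`, where it is maximal, so it is maximal
on `u` and `v` as well. -/
theorem IsFaceFamily.exchange {P : Type*} {V : Set (Finset P)}
    {T : Finset (Finset P)} (hT : IsFaceFamily V T) {a b u v : Finset P} (ha : a ∈ T) (hb : b ∈ T)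
    (hu : u ∈ V) (hv : v ∈ V)
    (hsum : ∀ w : P → ℝ, ∑ p ∈ u, w p + ∑ p ∈ v, w p = ∑ p ∈ a, w p + ∑ p ∈ b, w p) :
    u ∈ T ∧ v ∈ T := by
  obtain ⟨hTV, w, c, hw⟩ := hT
  have h1 := (hw a (hTV ha)).2.2 ha
  have h2 := (hw b (hTV hb)).2.2 hb
  have h3 := (hw u hu).1
  have h4 := (hw v hv).1
  have h5 := hsum w
  exact ⟨(hw u hu).2.1 (by linarith), (hw v hv).2.1 (by linarith)⟩

theorem eq_of_card_eq_three {α : Type*} {T : Finset α} (hT : T.card = 3) {a b u v : α}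
    (ha : a ∈ T) (hb : b ∈ T) (hu : u ∈ T) (hv : v ∈ T) (hab : a ≠ b) (hau : a ≠ u) (hbu : b ≠ u)
    (hav : a ≠ v) (hbv : b ≠ v) : u = v := by
  classical
  by_contra huv
  have h1 : ({a, b, u, v} : Finset α).card = 4 := by
    rw [Finset.card_insert_of_notMem (by simp [*]), Finset.card_insert_of_notMem (by simp [*]),
      Finset.card_pair huv]
  have h2 : ({a, b, u, v} : Finset α) ⊆ T := by
    intro x hx
    simp only [Finset.mem_insert, Finset.mem_singleton] at hx
    rcases hx with rfl | rfl | rfl | rfl <;> assumption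
  have := Finset.card_le_card h2
  omega

-- Since `s` lies in exactly one of `a`, `b`, toggling it in both preserves the sum of the
-- indicators. Exchange then puts both toggled sets in `T`, and three members leave room only if
-- toggling swaps `a` and `b`.
open scoped symmDiff in
theorem IsFaceFamily.symmDiff_eq_singleton {P : Type*} [DecidableEq P] {V : Set (Finset P)}
    {T : Finset (Finset P)} (hT : IsFaceFamily V T) (hc : T.card = 3) {a b : Finset P} (ha : a ∈ T)
    (hb : b ∈ T) {s : P} (hs : s ∈ a ∆ b) (hu : a ∆ {s} ∈ V) (hv : b ∆ {s} ∈ V) :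
    a ∆ b = {s} := by
  have hfin : ∀ (x : Finset P) (w : P → ℝ), ∑ p ∈ x ∆ {s}, w p =
      ∑ p ∈ x, w p + if s ∈ x then - w s else w s := by
    intro x w
    split_ifs with h
    · have : x ∆ {s} = x.erase s := by
        ext q; simp only [Finset.mem_symmDiff, Finset.mem_singleton, Finset.mem_erase]; grind
      rw [this, ← Finset.sum_erase_add _ _ h]; ring
    · have : x ∆ {s} = insert s x := by
        ext q; simp only [Finset.mem_symmDiff, Finset.mem_singleton, Finset.mem_insert]; grind
      rw [this, Finset.sum_insert h]; ring
  have hex := hT.exchange ha hb hu hv (fun w => by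
    rw [hfin, hfin]
    rcases Finset.mem_symmDiff.1 hs with h | h <;> simp [h.1, h.2] <;> ring)
  have hab : a ≠ b := by rintro rfl; simp at hs
  by_contra hne
  have h1 : ∀ x : Finset P, x ≠ x ∆ {s} := fun x h => by
    have : x ∆ (x ∆ {s}) = {s} := by simp
    rw [← h] at this
    simp at this
  have h2 : b ≠ a ∆ {s} := fun h => hne (by rw [h]; simp)
  have h3 : a ≠ b ∆ {s} := fun h => hne (by rw [h, symmDiff_comm, symmDiff_symmDiff_cancel_left])
  have := eq_of_card_eq_three hc ha hb hex.1 hex.2 hab (h1 a) h2 h3 (h1 b)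
  exact hab (symmDiff_left_injective _ this)

/-! ### Vertices of the order polytope and of the chain polytope -/

theorem eq_zero_of_mem_extremePoints {E : Type*} [AddCommGroup E] [Module ℝ E] {A : Set E}
    {x d : E} (hx : x ∈ A.extremePoints ℝ) (h1 : x + d ∈ A) (h2 : x - d ∈ A) : d = 0 := by
  have := hx.2 h1 h2 ⟨1 / 2, 1 / 2, by norm_num, by norm_num, by norm_num, by
    rw [← smul_add, add_add_sub_cancel, ← two_smul ℝ x, smul_smul]; norm_num⟩
  simpa using this

theorem eq_indVec_of_mul_self {P : Type*} [Fintype P] [DecidableEq P] {x : P → ℝ}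
    (h : ∀ p, x p = x p * x p) :
    x = indVec (Finset.univ.filter fun p => x p = 1) := by
  ext p
  rw [indVec_apply]
  simp only [Finset.mem_filter, Finset.mem_univ, true_and]
  split_ifs with h1
  · exact h1
  · have : x p * (x p - 1) = 0 := by linear_combination -h p
    rcases mul_eq_zero.1 this with h0 | h0
    · exact h0
    · exact absurd (by linarith) h1

theorem convex_orderPolytope (P : Type*) [PartialOrder P] : Convex ℝ (orderPolytope P) := by
  rintro x ⟨hx, hx'⟩ y ⟨hy, hy'⟩ a b ha hb hab
  refine ⟨fun p => ⟨?_, ?_⟩, fun p q hpq => ?_⟩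
  · have := mul_nonneg ha (hx p).1
    have := mul_nonneg hb (hy p).1
    simp only [Pi.add_apply, Pi.smul_apply, smul_eq_mul]
    linarith
  · have := mul_le_mul_of_nonneg_left (hx p).2 ha
    have := mul_le_mul_of_nonneg_left (hy p).2 hb
    simp only [Pi.add_apply, Pi.smul_apply, smul_eq_mul]
    linarith
  · have := mul_le_mul_of_nonneg_left (hx' p q hpq) ha
    have := mul_le_mul_of_nonneg_left (hy' p q hpq) hb
    simp only [Pi.add_apply, Pi.smul_apply, smul_eq_mul]
    linarith

theorem convex_chainPolytope (P : Type*) [PartialOrder P] : Convex ℝ (chainPolytope P) := by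
  rintro x ⟨hx, hx'⟩ y ⟨hy, hy'⟩ a b ha hb hab
  refine ⟨fun p => ?_, fun s hs => ?_⟩
  · have := mul_nonneg ha (hx p)
    have := mul_nonneg hb (hy p)
    simp only [Pi.add_apply, Pi.smul_apply, smul_eq_mul]
    linarith
  · have := mul_le_mul_of_nonneg_left (hx' s hs) ha
    have := mul_le_mul_of_nonneg_left (hy' s hs) hb
    simp only [Pi.add_apply, Pi.smul_apply, smul_eq_mul, Finset.sum_add_distrib,
      ← Finset.mul_sum]
    linarith

theorem isCompact_orderPolytope (P : Type*) [PartialOrder P] : IsCompact (orderPolytope P) := by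
  have hcube : IsCompact (Set.univ.pi fun _ : P => Set.Icc (0 : ℝ) 1) :=
    isCompact_univ_pi fun _ => isCompact_Icc
  refine hcube.of_isClosed_subset ?_ fun x hx p _ => hx.1 p
  simp only [orderPolytope, Set.ofPred_and, Set.ofPred_forall]
  refine (isClosed_iInter fun p => ?_).inter
    (isClosed_iInter fun p => isClosed_iInter fun q => isClosed_iInter fun _ => ?_)
  · exact (isClosed_le continuous_const (continuous_apply p)).inter
      (isClosed_le (continuous_apply p) continuous_const)
  · exact isClosed_le (continuous_apply q) (continuous_apply p)

theorem le_one_of_mem_chainPolytope {P : Type*} [PartialOrder P] {x : P → ℝ}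
    (hx : x ∈ chainPolytope P) (p : P) : x p ≤ 1 := by
  simpa using hx.2 {p} (by simp [IsChain])

theorem isCompact_chainPolytope (P : Type*) [PartialOrder P] : IsCompact (chainPolytope P) := by
  have hcube : IsCompact (Set.univ.pi fun _ : P => Set.Icc (0 : ℝ) 1) :=
    isCompact_univ_pi fun _ => isCompact_Icc
  refine hcube.of_isClosed_subset ?_ fun x hx p _ => ⟨hx.1 p, le_one_of_mem_chainPolytope hx p⟩
  simp only [chainPolytope, Set.ofPred_and, Set.ofPred_forall]
  refine (isClosed_iInter fun p => ?_).inter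
    (isClosed_iInter fun s => isClosed_iInter fun _ => ?_)
  · exact isClosed_le continuous_const (continuous_apply p)
  · exact isClosed_le (continuous_finsetSum _ fun p _ => continuous_apply p) continuous_const

theorem orderPolytope_eq_convexHull (P : Type*) [PartialOrder P] [Finite P] :
    orderPolytope P = convexHull ℝ (indVec '' {v : Finset P | IsLowerSet (v : Set P)}) := by
  classical
  cases nonempty_fintype P
  refine eq_convexHull_indVec (isCompact_orderPolytope P) (convex_orderPolytope P)
    (fun v hv => ⟨fun p => ?_, fun p q hpq => ?_⟩) fun x hx => ?_
  · rw [indVec_apply]; split_ifs <;> simp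
  · rw [indVec_apply, indVec_apply]
    by_cases hq : q ∈ v
    · have hp : p ∈ v := hv hpq hq
      simp [hp, hq]
    · rw [if_neg hq]; split_ifs <;> simp
  · obtain ⟨h01, hmono⟩ := hx.1
    -- The maps `t ↦ t ± t (1 - t)` are monotone from `[0, 1]` to itself, so they preserve the
    -- polytope when applied coordinatewise. Extremality makes the perturbation vanish.
    have hd : (fun p => x p - x p * x p) = 0 := by
      refine eq_zero_of_mem_extremePoints hx ⟨fun p => ?_, fun p q hpq => ?_⟩
        ⟨fun p => ?_, fun p q hpq => ?_⟩
      · obtain ⟨h0, h1⟩ := h01 p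
        simp only [Pi.add_apply]
        constructor <;> nlinarith
      · obtain ⟨h0, h1⟩ := h01 p
        obtain ⟨h0', h1'⟩ := h01 q
        have := hmono p q hpq
        simp only [Pi.add_apply]
        nlinarith
      · obtain ⟨h0, h1⟩ := h01 p
        simp only [Pi.sub_apply]
        constructor <;> nlinarith
      · obtain ⟨h0, h1⟩ := h01 p
        obtain ⟨h0', h1'⟩ := h01 q
        have := hmono p q hpq
        simp only [Pi.sub_apply]
        nlinarith
    refine ⟨_, ?_, (eq_indVec_of_mul_self fun p => sub_eq_zero.1 (congrFun hd p)).symm⟩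
    intro q p hpq hq
    simp only [Finset.coe_filter, Finset.mem_univ, true_and, Set.mem_ofPred_eq] at hq ⊢
    have := hmono p q hpq
    exact le_antisymm (h01 p).2 (hq ▸ this)

section Ranked

variable {P : Type*} [PartialOrder P] {r : P → ℕ}

theorem card_filter_rank_le_one (hr : ∀ p q : P, p < q ↔ r p < r q) {s : Finset P}
    (hs : IsChain (· ≤ ·) (s : Set P)) (n : ℕ) : (s.filter fun p => r p = n).card ≤ 1 := by
  rw [Finset.card_le_one]
  intro a ha b hb
  simp only [Finset.mem_filter] at ha hb
  by_contra hab
  rcases hs ha.1 hb.1 hab with h | h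
  · have := (hr _ _).1 (lt_of_le_of_ne h hab); omega
  · have := (hr _ _).1 (lt_of_le_of_ne h (Ne.symm hab)); omega

theorem mem_chainPolytope_of_support (hr : ∀ p q : P, p < q ↔ r p < r q) {x : P → ℝ} {n : ℕ}
    (h01 : ∀ p, 0 ≤ x p ∧ x p ≤ 1) (hsupp : ∀ p, r p ≠ n → x p = 0) : x ∈ chainPolytope P := by
  classical
  refine ⟨fun p => (h01 p).1, fun s hs => ?_⟩
  rw [← Finset.sum_filter_add_sum_filter_not s (fun p => r p = n),
    Finset.sum_eq_zero (s := s.filter fun p => ¬ r p = n)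
      (fun p hp => hsupp p (Finset.mem_filter.1 hp).2), add_zero]
  refine (Finset.sum_le_card_nsmul _ _ 1 fun p _ => (h01 p).2).trans ?_
  rw [nsmul_eq_mul, mul_one]
  exact_mod_cast card_filter_rank_le_one hr hs n

/-- In a weak order, a vertex of the chain polytope is supported on a single level. -/
theorem eq_zero_of_mem_extremePoints_chainPolytope [Finite P]
    (hr : ∀ p q : P, p < q ↔ r p < r q) {x : P → ℝ}
    (hx : x ∈ (chainPolytope P).extremePoints ℝ) {p₀ q : P} (hp₀ : 0 < x p₀) (hq : r q ≠ r p₀) :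
    x q = 0 := by
  classical
  cases nonempty_fintype P
  obtain ⟨p, hp, hmax⟩ := (Finset.univ.filter fun p => r p = r p₀).exists_max_image x
    ⟨p₀, by simp⟩
  simp only [Finset.mem_filter, Finset.mem_univ, true_and] at hp hmax
  have hpos : 0 < x p := hp₀.trans_le (hmax p₀ rfl)
  have hp1 := le_one_of_mem_chainPolytope hx.1 p
  -- A chain has at most one element on the level of `p`. Its remaining elements form a chain
  -- together with `p`, so their sum is at most `1 - x p`.
  have hbd : ∀ s : Finset P, IsChain (· ≤ ·) (s : Set P) →
      ∑ a ∈ s with r a = r p₀, x a ≤ x p ∧ ∑ a ∈ s with ¬ r a = r p₀, x a ≤ 1 - x p := by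
    intro s hs
    constructor
    · refine (Finset.sum_le_card_nsmul _ _ (x p) fun a ha =>
        hmax a (Finset.mem_filter.1 ha).2).trans ?_
      rw [nsmul_eq_mul]
      have : ((s.filter fun a => r a = r p₀).card : ℝ) ≤ 1 := by
        exact_mod_cast card_filter_rank_le_one hr hs _
      nlinarith
    · have hch : IsChain (· ≤ ·) ((insert p (s.filter fun a => ¬ r a = r p₀) : Finset P) : Set P) := by
        rw [Finset.coe_insert]
        refine IsChain.insert (hs.mono (Finset.coe_subset.2 (Finset.filter_subset _ _))) ?_
        intro b hb _
        have hb' : r b ≠ r p := by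
          rw [hp]; exact (Finset.mem_filter.1 (Finset.mem_coe.1 hb)).2
        rcases lt_or_gt_of_ne hb' with h | h
        · exact Or.inr ((hr _ _).2 h).le
        · exact Or.inl ((hr _ _).2 h).le
      have := hx.1.2 _ hch
      rw [Finset.sum_insert (by simp [hp])] at this
      linarith
  -- With `m = x p`, the level is scaled by `1 ± (1 - m)` and everything else by `1 ∓ m`. The chain
  -- bounds survive because `(2 - m) m + (1 - m)² = 1` and `m² + (1 + m)(1 - m) = 1`.
  have hd : (fun a => if r a = r p₀ then x a * (1 - x p) else - (x p * x a)) = 0 := by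
    refine eq_zero_of_mem_extremePoints hx ⟨fun a => ?_, fun s hs => ?_⟩
      ⟨fun a => ?_, fun s hs => ?_⟩
    · have := hx.1.1 a
      simp only [Pi.add_apply]
      split_ifs <;> nlinarith
    · obtain ⟨h1, h2⟩ := hbd s hs
      rw [← Finset.sum_filter_add_sum_filter_not s (fun a => r a = r p₀)]
      rw [Finset.sum_congr rfl (g := fun a => (2 - x p) * x a) fun a ha => by
          simp only [Pi.add_apply, if_pos (Finset.mem_filter.1 ha).2]; ring,
        Finset.sum_congr (s₁ := s.filter fun a => ¬ r a = r p₀) rfl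
          (g := fun a => (1 - x p) * x a) fun a ha => by
            simp only [Pi.add_apply, if_neg (Finset.mem_filter.1 ha).2]; ring,
        ← Finset.mul_sum, ← Finset.mul_sum]
      nlinarith
    · have := hx.1.1 a
      simp only [Pi.sub_apply]
      split_ifs <;> nlinarith
    · obtain ⟨h1, h2⟩ := hbd s hs
      rw [← Finset.sum_filter_add_sum_filter_not s (fun a => r a = r p₀)]
      rw [Finset.sum_congr rfl (g := fun a => x p * x a) fun a ha => by
          simp only [Pi.sub_apply, if_pos (Finset.mem_filter.1 ha).2]; ring,
        Finset.sum_congr (s₁ := s.filter fun a => ¬ r a = r p₀) rfl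
          (g := fun a => (1 + x p) * x a) fun a ha => by
            simp only [Pi.sub_apply, if_neg (Finset.mem_filter.1 ha).2]; ring,
        ← Finset.mul_sum, ← Finset.mul_sum]
      nlinarith
  have := congrFun hd q
  simp only [if_neg hq, Pi.zero_apply, neg_eq_zero, mul_eq_zero] at this
  exact this.resolve_left hpos.ne'

theorem chainPolytope_eq_convexHull [Finite P] (hr : ∀ p q : P, p < q ↔ r p < r q) :
    chainPolytope P =
      convexHull ℝ (indVec '' {v : Finset P | IsAntichain (· ≤ ·) (v : Set P)}) := by
  classical
  cases nonempty_fintype P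
  refine eq_convexHull_indVec (isCompact_chainPolytope P) (convex_chainPolytope P)
    (fun v hv => ⟨fun p => ?_, fun s hs => ?_⟩) fun x hx => ?_
  · rw [indVec_apply]; split_ifs <;> simp
  · have hsum : ∑ p ∈ s, indVec v p = ((s ∩ v).card : ℝ) := by
      simp [indVec_apply]
    rw [hsum]
    have : (s ∩ v).card ≤ 1 := by
      rw [Finset.card_le_one]
      intro a ha b hb
      simp only [Finset.mem_inter] at ha hb
      by_contra hab
      rcases hs ha.1 hb.1 hab with h | h
      · exact hv ha.2 hb.2 hab h
      · exact hv hb.2 ha.2 (Ne.symm hab) h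
    exact_mod_cast this
  · by_cases h0 : ∃ p₀, 0 < x p₀
    · obtain ⟨p₀, hp₀⟩ := h0
      have hsupp : ∀ q, r q ≠ r p₀ → x q = 0 := fun q =>
        eq_zero_of_mem_extremePoints_chainPolytope hr hx hp₀
      -- A vector supported on one level only has to stay in the cube, so `t ↦ t ± t (1 - t)` works
      -- here as well.
      have hd : (fun p => x p - x p * x p) = 0 := by
        refine eq_zero_of_mem_extremePoints hx
          (mem_chainPolytope_of_support hr (n := r p₀) (fun p => ?_) fun p hp => ?_)
          (mem_chainPolytope_of_support hr (n := r p₀) (fun p => ?_) fun p hp => ?_)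
        · have h0 := hx.1.1 p
          have h1 := le_one_of_mem_chainPolytope hx.1 p
          simp only [Pi.add_apply]
          constructor <;> nlinarith
        · simp [hsupp p hp]
        · have h0 := hx.1.1 p
          have h1 := le_one_of_mem_chainPolytope hx.1 p
          simp only [Pi.sub_apply]
          constructor <;> nlinarith
        · simp [hsupp p hp]
      refine ⟨_, ?_, (eq_indVec_of_mul_self fun p => sub_eq_zero.1 (congrFun hd p)).symm⟩
      intro a ha b hb hab hle
      simp only [Finset.coe_filter, Finset.mem_univ, true_and, Set.mem_ofPred_eq] at ha hb
      have h1 : r a = r p₀ := by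
        by_contra h; rw [hsupp a h] at ha; exact zero_ne_one ha
      have h2 : r b = r p₀ := by
        by_contra h; rw [hsupp b h] at hb; exact zero_ne_one hb
      have := (hr _ _).1 (lt_of_le_of_ne hle hab)
      omega
    · push Not at h0
      refine ⟨∅, by simp, ?_⟩
      ext p
      rw [indVec_apply, if_neg (Finset.notMem_empty p)]
      exact le_antisymm (hx.1.1 p) (h0 p)

end Ranked

/-! ### The rank function, and unordered triples -/

/-- In a maximal ranked poset the height is an `ℕ`-valued rank function which determines the
order, and it attains every value below one of its values. -/
theorem IsMaximalRanked.exists_rank {P : Type*} [PartialOrder P] [Finite P]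
    (hP : IsMaximalRanked P) : ∃ r : P → ℕ, (∀ p q : P, p < q ↔ r p < r q) ∧
      ∀ (p : P) (n : ℕ), n < r p → ∃ q, r q = n := by
  have hfin : ∀ p : P, Order.height p < ⊤ := fun p => by
    by_contra h
    cases nonempty_fintype P
    have htop : Order.height p = ⊤ := not_lt_top_iff.1 h
    obtain ⟨s, -, hs⟩ := Order.exists_series_of_le_height p (n := Fintype.card P)
      (by rw [htop]; exact le_top)
    have := Fintype.card_le_of_injective s s.strictMono.injective
    simp [hs] at this
  have hc : ∀ p : P, ((Order.height p).toNat : ℕ∞) = Order.height p := fun p =>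
    ENat.natCast_toNat (hfin p).ne
  have hiff : ∀ p q : P, (Order.height p).toNat < (Order.height q).toNat ↔
      Order.height p < Order.height q := fun p q => by
    rw [← hc p, ← hc q]; simp
  refine ⟨fun p => (Order.height p).toNat, fun p q => ⟨fun h => ?_, fun h => ?_⟩, fun p n hn => ?_⟩
  · exact (hiff p q).2 (Order.height_strictMono h (hfin p))
  · have h' := (hiff p q).1 h
    rcases hP.2 p q h'.ne with hle | hle
    · exact lt_of_le_of_ne hle (by rintro rfl; exact lt_irrefl _ h')
    · exact absurd (Order.height_mono hle) (not_le.2 h')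
  · have hn' : (n : ℕ∞) < Order.height p := by
      rw [← hc p]; exact_mod_cast hn
    obtain ⟨y, -, hy⟩ := (Order.coe_lt_height_iff (hfin p)).1 hn'
    exact ⟨y, by simp [hy]⟩

theorem exists_sorted_triple {α β : Type*} [DecidableEq α] [LinearOrder β] {T : Finset α}
    (hT : T.card = 3) (g : α → β) : ∃ a b c, T = {a, b, c} ∧ a ≠ b ∧ a ≠ c ∧ b ≠ c ∧
      g a ≤ g b ∧ g b ≤ g c := by
  obtain ⟨a, b, c, hab, hac, hbc, rfl⟩ := Finset.card_eq_three.1 hT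
  rcases le_total (g a) (g b) with h1 | h1 <;> rcases le_total (g b) (g c) with h2 | h2 <;>
    rcases le_total (g a) (g c) with h3 | h3
  · exact ⟨a, b, c, rfl, hab, hac, hbc, h1, h2⟩
  · exact ⟨a, b, c, rfl, hab, hac, hbc, h1, h2⟩
  · exact ⟨a, c, b, by grind, hac, hab, hbc.symm, h3, h2⟩
  · exact ⟨c, a, b, by grind, hac.symm, hbc.symm, hab, h3, h1⟩
  · exact ⟨b, a, c, by grind, hab.symm, hbc, hac, h1, h3⟩
  · exact ⟨b, c, a, by grind, hbc, hab.symm, hac.symm, h2, h3⟩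
  · exact ⟨c, b, a, by grind, hbc.symm, hac.symm, hab.symm, h2, h1⟩
  · exact ⟨c, b, a, by grind, hbc.symm, hac.symm, hab.symm, h2, h1⟩

/-- The first entry is the strict minimum for `g` and the last the strict maximum for `k`. Two keys
are allowed because the middle entry of a chain triple may be empty. -/
theorem triple_eq_of_lt {α β γ : Type*} [DecidableEq α] [LinearOrder β] [LinearOrder γ]
    {g : α → β} {k : α → γ} {a b c a' b' c' : α} (h : ({a, b, c} : Finset α) = {a', b', c'})
    (h1 : g a < g b) (h2 : g a < g c) (h1' : g a' < g b') (h2' : g a' < g c')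
    (h3 : k a < k c) (h4 : k b < k c) (h3' : k a' < k c') (h4' : k b' < k c') :
    a = a' ∧ b = b' ∧ c = c' := by
  have hm : ∀ x, (x = a ∨ x = b ∨ x = c) ↔ (x = a' ∨ x = b' ∨ x = c') := fun x => by
    simpa using Finset.ext_iff.1 h x
  have ha : a = a' := by
    rcases (hm a).1 (by simp) with e | e | e
    · exact e
    · rcases (hm a').2 (by simp) with e' | e' | e'
      · exact e'.symm
      · rw [e'] at h1'; rw [← e] at h1'; exact absurd h1' h1.not_gt
      · rw [e'] at h1'; rw [← e] at h1'; exact absurd h1' h2.not_gt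
    · rcases (hm a').2 (by simp) with e' | e' | e'
      · exact e'.symm
      · rw [e'] at h2'; rw [← e] at h2'; exact absurd h2' h1.not_gt
      · rw [e'] at h2'; rw [← e] at h2'; exact absurd h2' h2.not_gt
  have hcc : c = c' := by
    rcases (hm c).1 (by simp) with e | e | e
    · rcases (hm c').2 (by simp) with e' | e' | e'
      · rw [e'] at h3'; rw [← e] at h3'; exact absurd h3' h3.not_gt
      · rw [e'] at h3'; rw [← e] at h3'; exact absurd h3' h4.not_gt
      · exact e'.symm
    · rcases (hm c').2 (by simp) with e' | e' | e'
      · rw [e'] at h4'; rw [← e] at h4'; exact absurd h4' h3.not_gt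
      · rw [e'] at h4'; rw [← e] at h4'; exact absurd h4' h4.not_gt
      · exact e'.symm
    · exact e
  subst ha hcc
  refine ⟨rfl, ?_, rfl⟩
  rcases (hm b).1 (by simp) with e | e | e
  · subst e; exact absurd h1 (lt_irrefl _)
  · exact e
  · subst e; exact absurd h4 (lt_irrefl _)

/-! ### Triangles of the order polytope as chains of three ideals -/

/-- `I` and `J` are ideals with `I ⊂ J`, and `J \ I` is a singleton or contains two comparable
elements. In a weak order the latter means that `J \ I` is connected. -/
def IsIdealEdge {P : Type*} [PartialOrder P] [DecidableEq P] (I J : Finset P) : Prop :=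
  IsLowerSet (I : Set P) ∧ IsLowerSet (J : Set P) ∧ I ⊂ J ∧
    ((∃ s ∉ I, J = insert s I) ∨ ∃ p ∈ J \ I, ∃ q ∈ J \ I, p < q)

section Order

variable {P : Type*} [PartialOrder P] [DecidableEq P]

/-- Incomparable ideals could be exchanged for their union and intersection, giving four members. -/
theorem IsFaceFamily.subset_or_subset {T : Finset (Finset P)}
    (hT : IsFaceFamily {v : Finset P | IsLowerSet (v : Set P)} T) (hc : T.card = 3)
    {I J : Finset P} (hI : I ∈ T) (hJ : J ∈ T) : I ⊆ J ∨ J ⊆ I := by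
  by_contra hcon
  push Not at hcon
  have hI' : IsLowerSet (I : Set P) := hT.1 hI
  have hJ' : IsLowerSet (J : Set P) := hT.1 hJ
  have hex := hT.exchange (u := I ∪ J) (v := I ∩ J) hI hJ
    (by simpa using hI'.union hJ') (by simpa using hI'.inter hJ')
    (fun w => Finset.sum_union_inter)
  have := eq_of_card_eq_three hc hI hJ hex.1 hex.2 (by grind) (by grind) (by grind) (by grind)
    (by grind)
  exact hcon.1 fun x hx => (Finset.mem_inter.1 (this ▸ Finset.mem_union_left J hx)).2

-- If `J \ I` has no comparable pair, any `s` in it can be added to `I` and removed from `J` within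
-- the ideals, so `J \ I` must be a singleton.
open scoped symmDiff in
theorem IsFaceFamily.isIdealEdge {T : Finset (Finset P)}
    (hT : IsFaceFamily {v : Finset P | IsLowerSet (v : Set P)} T) (hc : T.card = 3)
    {I J : Finset P} (hI : I ∈ T) (hJ : J ∈ T) (hIJ : I ⊂ J) : IsIdealEdge I J := by
  have hI' : IsLowerSet (I : Set P) := hT.1 hI
  have hJ' : IsLowerSet (J : Set P) := hT.1 hJ
  refine ⟨hI', hJ', hIJ, ?_⟩
  by_contra hcon
  push Not at hcon
  obtain ⟨hins, hincomp⟩ := hcon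
  obtain ⟨s, hsJ, hsI⟩ := Finset.exists_of_ssubset hIJ
  have h1 : I ∆ {s} = insert s I := by ext q; grind [Finset.mem_symmDiff]
  have h2 : J ∆ {s} = J.erase s := by ext q; grind [Finset.mem_symmDiff]
  have h := hT.symmDiff_eq_singleton hc hI hJ (s := s) (Finset.mem_symmDiff.2 (Or.inr ⟨hsJ, hsI⟩))
    ?_ ?_
  · refine hins s hsI ?_
    ext q
    have := Finset.ext_iff.1 h q
    have := @hIJ.1 q
    grind [Finset.mem_symmDiff]
  · rw [h1]
    intro a b hba ha
    simp only [Finset.coe_insert, Set.mem_insert_iff, Finset.mem_coe] at ha ⊢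
    rcases ha with rfl | ha
    · by_contra hb
      push Not at hb
      exact hincomp b (by simp [hb.2, show b ∈ J from hJ' hba hsJ]) a (by simp [hsJ, hsI])
        (lt_of_le_of_ne hba hb.1)
    · exact Or.inr (hI' hba ha)
  · rw [h2]
    intro a b hba ha
    simp only [Finset.coe_erase, Set.mem_sdiff, Finset.mem_coe, Set.mem_singleton_iff] at ha ⊢
    refine ⟨hJ' hba ha.1, ?_⟩
    rintro rfl
    refine hincomp b (by simp [hsJ, hsI]) a ?_ (lt_of_le_of_ne hba (Ne.symm ha.2))
    simp only [Finset.mem_sdiff]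
    exact ⟨ha.1, fun h => hsI (hI' hba h)⟩

theorem IsFaceFamily.exists_idealEdges {T : Finset (Finset P)}
    (hT : IsFaceFamily {v : Finset P | IsLowerSet (v : Set P)} T) (hc : T.card = 3) :
    ∃ I J K, T = {I, J, K} ∧ IsIdealEdge I J ∧ IsIdealEdge J K ∧ IsIdealEdge I K := by
  obtain ⟨I, J, K, rfl, hIJ, hIK, hJK, h1, h2⟩ := exists_sorted_triple hc Finset.card
  have key : ∀ A ∈ ({I, J, K} : Finset (Finset P)), ∀ B ∈ ({I, J, K} : Finset (Finset P)),
      A ≠ B → A.card ≤ B.card → IsIdealEdge A B := by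
    intro A hA B hB hAB hcard
    refine hT.isIdealEdge hc hA hB ?_
    rcases hT.subset_or_subset hc hA hB with h | h
    · exact h.ssubset_of_ne hAB
    · exact absurd (Finset.eq_of_subset_of_card_le h hcard).symm hAB
  exact ⟨I, J, K, rfl, key _ (by simp) _ (by simp) hIJ h1, key _ (by simp) _ (by simp) hJK h2,
    key _ (by simp) _ (by simp) hIK (h1.trans h2)⟩

/-- If `v` is closed under the relations inside `J \ I`, it contains all of `J \ I` or nothing. -/
theorem IsIdealEdge.subset_or_disjoint {r : P → ℕ} (hr : ∀ p q : P, p < q ↔ r p < r q)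
    {I J v : Finset P} (h : IsIdealEdge I J) (hv : IsLowerSet (v : Set P))
    (hcl : ∀ p ∈ J \ I, ∀ q ∈ J \ I, p < q → p ∈ v → q ∈ v) :
    (∀ a ∈ J \ I, a ∈ v) ∨ ∀ a ∈ J \ I, a ∉ v := by
  obtain ⟨-, -, -, ⟨s, hs, rfl⟩ | ⟨p, hp, q, hq, hpq⟩⟩ := h
  · by_cases hsv : s ∈ v
    · left; intro a ha; grind
    · right; intro a ha; grind
  · have hiff : ∀ a ∈ J \ I, ∀ b ∈ J \ I, a < b → (a ∈ v ↔ b ∈ v) := fun a ha b hb hab =>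
      ⟨hcl a ha b hb hab, fun h => hv hab.le h⟩
    have hall : ∀ a ∈ J \ I, (a ∈ v ↔ p ∈ v) := by
      intro a ha
      rcases lt_trichotomy (r a) (r p) with h | h | h
      · exact hiff a ha p hp ((hr _ _).2 h)
      · rw [hiff a ha q hq ((hr _ _).2 (h ▸ (hr _ _).1 hpq)), hiff p hp q hq hpq]
      · exact (hiff p hp a ha ((hr _ _).2 h)).symm
    by_cases hpv : p ∈ v
    · left; exact fun a ha => (hall a ha).2 hpv
    · right; exact fun a ha h => hpv ((hall a ha).1 h)

theorem isFaceFamily_of_idealEdges [Finite P] {r : P → ℕ} (hr : ∀ p q : P, p < q ↔ r p < r q)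
    {I J K : Finset P} (hIJ : IsIdealEdge I J) (hJK : IsIdealEdge J K) (hIK : IsIdealEdge I K) :
    IsFaceFamily {v : Finset P | IsLowerSet (v : Set P)} {I, J, K} := by
  have s1 := hIJ.2.2.1
  have s2 := hJK.2.2.1
  refine isFaceFamily_of_separated ?_ fun v hv hvT => ?_
  · intro t ht
    simp only [Finset.coe_insert, Finset.coe_singleton, Set.mem_insert_iff,
      Set.mem_singleton_iff] at ht
    rcases ht with rfl | rfl | rfl
    exacts [hIJ.1, hIJ.2.1, hIK.2.1]
  by_contra hcon
  -- An ideal `v` that cannot be separated satisfies with equality every valid inequality tight on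
  -- `I`, `J`, `K`. The ones used are `x p ≤ 1` on `I`, `x p ≥ 0` off `K`, and `x q ≤ x p` for `p <
  -- q` in the same block cut out by the three ideals.
  have hsep : ∀ (w : P → ℝ) (c : ℝ), (∀ u : Finset P, IsLowerSet (u : Set P) → ∑ p ∈ u, w p ≤ c) →
      ∑ p ∈ I, w p = c → ∑ p ∈ J, w p = c → ∑ p ∈ K, w p = c → c ≤ ∑ p ∈ v, w p := by
    intro w c h1 h2 h3 h4
    by_contra hlt
    exact hcon ⟨w, c, h1, by simp [h2, h3, h4], not_le.1 hlt⟩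
  have f1 : ∀ p ∈ I, p ∈ v := fun p hp => by
    have := hsep (fun q => if q = p then 1 else 0) 1 (fun u _ => by
      simp only [Finset.sum_ite_eq']; split_ifs <;> simp) (by simp [hp]) (by simp [s1.1 hp])
      (by simp [s2.1 (s1.1 hp)])
    by_contra hpv
    norm_num [Finset.sum_ite_eq', hpv] at this
  have f2 : ∀ p ∈ v, p ∈ K := fun p hp => by
    by_contra hpK
    have hpJ : p ∉ J := fun h => hpK (s2.1 h)
    have hpI : p ∉ I := fun h => hpJ (s1.1 h)
    have := hsep (fun q => if q = p then -1 else 0) 0 (fun u _ => by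
      simp only [Finset.sum_ite_eq']; split_ifs <;> simp) (by simp [hpI]) (by simp [hpJ])
      (by simp [hpK])
    norm_num [Finset.sum_ite_eq', hp] at this
  have f3 : ∀ p q, p < q → (p ∈ I ↔ q ∈ I) → (p ∈ J ↔ q ∈ J) → (p ∈ K ↔ q ∈ K) → p ∈ v →
      q ∈ v := fun p q hpq h1 h2 h3 hp => by
    have hsum : ∀ u : Finset P, ∑ a ∈ u, ((if a = q then (1 : ℝ) else 0) - if a = p then 1 else 0) =
        (if q ∈ u then 1 else 0) - if p ∈ u then 1 else 0 := fun u => by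
      rw [Finset.sum_sub_distrib, Finset.sum_ite_eq', Finset.sum_ite_eq']
    have := hsep (fun a => (if a = q then (1 : ℝ) else 0) - if a = p then 1 else 0) 0 (fun u hu => by
      rw [hsum]
      by_cases hq : q ∈ u
      · have hp : p ∈ u := hu hpq.le hq
        simp [hq, hp]
      · rw [if_neg hq]; split_ifs <;> simp) (by rw [hsum]; simp [h1]) (by rw [hsum]; simp [h2])
      (by rw [hsum]; simp [h3])
    rw [hsum, if_pos hp] at this
    by_contra hq
    norm_num [hq] at this
  have hD := hIJ.subset_or_disjoint hr hv fun p hp q hq hpq hpv =>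
    f3 p q hpq (by grind) (by grind) (by grind) hpv
  have hE := hJK.subset_or_disjoint hr hv fun p hp q hq hpq hpv =>
    f3 p q hpq (by grind) (by grind) (by grind) hpv
  -- Now `v` is `I` together with some of the blocks `J \ I` and `K \ J`. Connectedness of `K \ I`
  -- yields a relation between these blocks, which forbids taking the upper one alone.
  have hDE : ∃ p ∈ J \ I, ∃ q ∈ K \ J, p < q := by
    obtain ⟨e, heK, heJ⟩ := Finset.exists_of_ssubset s2
    obtain ⟨d, hdJ, hdI⟩ := Finset.exists_of_ssubset s1
    have hJl : ∀ a ∈ J, ∀ b ∉ J, r a ≤ r b := fun a ha b hb => by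
      by_contra h
      exact hb (hIJ.2.1 ((hr b a).2 (not_le.1 h)).le ha)
    obtain ⟨-, -, -, ⟨s, hs, hK⟩ | ⟨p, hp, q, hq, hpq⟩⟩ := hIK
    · have := s2.1 hdJ
      grind
    · have hpq' := (hr p q).1 hpq
      by_cases hpJ : p ∈ J
      · by_cases hqJ : q ∈ J
        · exact ⟨p, by grind, e, by grind, (hr _ _).2 (hpq'.trans_le (hJl q hqJ e heJ))⟩
        · exact ⟨p, by grind, q, by grind, hpq⟩
      · exact ⟨d, by grind, q, by
          have : q ∉ J := fun h => hpJ (hIJ.2.1 hpq.le h)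
          grind, (hr _ _).2 ((hJl d hdJ p hpJ).trans_lt hpq')⟩
  obtain ⟨p, hp, q, hq, hpq⟩ := hDE
  apply hvT
  simp only [Finset.mem_insert, Finset.mem_singleton]
  have hIJ' := s1.1
  have hJK' := s2.1
  rcases hD with hD | hD
  · rcases hE with hE | hE
    · right; right; ext a; grind
    · right; left; ext a; grind
  · rcases hE with hE | hE
    · exact absurd (hv hpq.le (hE q hq)) (hD p hp)
    · left; ext a; grind

end Order

/-! ### Encoding chains of ideals by triples of level subsets -/

/-- The rank of the elements of a nonempty subset of a level. -/
def rankOf {P : Type*} (r : P → ℕ) (X : Finset P) : ℕ := X.sup r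

/-- `X` is a nonempty subset of a level of the rank function `r`. -/
def IsLevelSubset {P : Type*} (r : P → ℕ) (X : Finset P) : Prop :=
  X.Nonempty ∧ ∀ p ∈ X, r p = rankOf r X

/-- The elements of rank `n`. -/
def level {P : Type*} [Fintype P] (r : P → ℕ) (n : ℕ) : Finset P :=
  Finset.univ.filter fun p => r p = n

/-- The largest ideal which is disjoint from `X`. -/
def idealBelow {P : Type*} [Fintype P] [DecidableEq P] (r : P → ℕ) (X : Finset P) : Finset P :=
  Finset.univ.filter fun p => r p < rankOf r X ∨ (r p = rankOf r X ∧ p ∉ X)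

/-- The ideal generated by `X`. -/
def idealUpTo {P : Type*} [Fintype P] [DecidableEq P] (r : P → ℕ) (X : Finset P) : Finset P :=
  Finset.univ.filter fun p => r p < rankOf r X ∨ p ∈ X

/-- The triples which index the triangular faces of the order polytope. -/
def IsOrderTriple {P : Type*} [Fintype P] [DecidableEq P] (r : P → ℕ) (X W Z : Finset P) : Prop :=
  IsLevelSubset r X ∧ IsLevelSubset r W ∧ IsLevelSubset r Z ∧ rankOf r X < rankOf r Z ∧
    -- The middle ideal ends partway through the level of `X`, of `Z`, or of an intermediate rank,
    -- or else it ends with a full level. In the last case a difference of ideals lying in a single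
    -- level must be a singleton.
    ((∃ x ∈ X, W = X.erase x) ∨ (∃ z ∈ Z, W = Z.erase z) ∨
      (rankOf r X < rankOf r W ∧ rankOf r W < rankOf r Z ∧ W ≠ level r (rankOf r W)) ∨
      (W = level r (rankOf r W) ∧ rankOf r X ≤ rankOf r W ∧ rankOf r W < rankOf r Z ∧
        (rankOf r X = rankOf r W → X.card = 1) ∧ (rankOf r W + 1 = rankOf r Z → Z.card = 1)))

/-- The middle ideal of the triangular face indexed by an order triple. -/
def middleIdeal {P : Type*} [Fintype P] [DecidableEq P] (r : P → ℕ) (X W : Finset P) : Finset P :=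
  if W ⊂ X then idealBelow r W else idealUpTo r W

section Level

variable {P : Type*} {r : P → ℕ}

theorem rankOf_eq {X : Finset P} {n : ℕ} (hX : X.Nonempty) (h : ∀ p ∈ X, r p = n) :
    rankOf r X = n :=
  le_antisymm (Finset.sup_le fun p hp => (h p hp).le) (by
    obtain ⟨p, hp⟩ := hX
    exact h p hp ▸ Finset.le_sup (f := r) hp)

theorem isLevelSubset_of {X : Finset P} {n : ℕ} (hX : X.Nonempty) (h : ∀ p ∈ X, r p = n) :
    IsLevelSubset r X :=
  ⟨hX, fun p hp => by rw [rankOf_eq hX h, h p hp]⟩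

theorem IsLevelSubset.rankOf_eq_of_subset {X Y : Finset P} (hX : IsLevelSubset r X)
    (hY : Y.Nonempty) (h : Y ⊆ X) : rankOf r Y = rankOf r X :=
  rankOf_eq hY fun p hp => hX.2 p (h hp)

theorem IsLevelSubset.subset {X Y : Finset P} (hX : IsLevelSubset r X)
    (hY : Y.Nonempty) (h : Y ⊆ X) : IsLevelSubset r Y :=
  isLevelSubset_of hY fun p hp => hX.2 p (h hp)

theorem mem_level [Fintype P] {n : ℕ} {p : P} : p ∈ level r n ↔ r p = n := by simp [level]

theorem IsLevelSubset.subset_level [Fintype P] {X : Finset P} (hX : IsLevelSubset r X) :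
    X ⊆ level r (rankOf r X) := fun p hp => mem_level.2 (hX.2 p hp)

variable [Fintype P] [DecidableEq P]

theorem mem_idealBelow {X : Finset P} {p : P} :
    p ∈ idealBelow r X ↔ r p < rankOf r X ∨ (r p = rankOf r X ∧ p ∉ X) := by
  simp [idealBelow]

theorem mem_idealUpTo {X : Finset P} {p : P} :
    p ∈ idealUpTo r X ↔ r p < rankOf r X ∨ p ∈ X := by
  simp [idealUpTo]

theorem IsLevelSubset.idealBelow_injective {X Y : Finset P} (hX : IsLevelSubset r X)
    (hY : IsLevelSubset r Y) (h : idealBelow r X = idealBelow r Y) : X = Y := by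
  have hm : ∀ p, _ ↔ _ := fun p => by simpa only [mem_idealBelow] using Finset.ext_iff.1 h p
  obtain ⟨⟨x, hx⟩, hX⟩ := hX
  obtain ⟨⟨y, hy⟩, hY⟩ := hY
  have h1 := hX x hx
  have h2 := hY y hy
  have h3 := hm x
  have h4 := hm y
  have h5 : rankOf r X = rankOf r Y := by
    rcases lt_trichotomy (rankOf r X) (rankOf r Y) with h | h | h
    · grind
    · exact h
    · grind
  ext p
  have := hm p
  have := hX p
  have := hY p
  grind

theorem IsLevelSubset.idealUpTo_injective {X Y : Finset P} (hX : IsLevelSubset r X)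
    (hY : IsLevelSubset r Y) (h : idealUpTo r X = idealUpTo r Y) : X = Y := by
  have hm : ∀ p, _ ↔ _ := fun p => by simpa only [mem_idealUpTo] using Finset.ext_iff.1 h p
  obtain ⟨⟨x, hx⟩, hX⟩ := hX
  obtain ⟨⟨y, hy⟩, hY⟩ := hY
  have h1 := hX x hx
  have h2 := hY y hy
  have h3 := hm x
  have h4 := hm y
  have h5 : rankOf r X = rankOf r Y := by
    rcases lt_trichotomy (rankOf r X) (rankOf r Y) with h | h | h
    · grind
    · exact h
    · grind
  ext p
  have := hm p
  have := hX p
  have := hY p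
  grind

/-- The ideal generated by a proper subset of a level is the largest ideal avoiding the rest of
that level. -/
theorem IsLevelSubset.sdiff {W : Finset P} (hW : IsLevelSubset r W)
    (h : W ≠ level r (rankOf r W)) :
    IsLevelSubset r (level r (rankOf r W) \ W) ∧
      rankOf r (level r (rankOf r W) \ W) = rankOf r W ∧
      idealUpTo r W = idealBelow r (level r (rankOf r W) \ W) := by
  obtain ⟨p, hp, hpW⟩ := Finset.exists_of_ssubset (hW.subset_level.ssubset_of_ne h)
  have hne : (level r (rankOf r W) \ W).Nonempty := ⟨p, by simp [hp, hpW]⟩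
  have hall : ∀ q ∈ level r (rankOf r W) \ W, r q = rankOf r W := fun q hq =>
    mem_level.1 (Finset.mem_sdiff.1 hq).1
  have hrk := rankOf_eq hne hall
  refine ⟨isLevelSubset_of hne hall, hrk, ?_⟩
  ext q
  rw [mem_idealUpTo, mem_idealBelow, hrk, Finset.mem_sdiff, mem_level]
  have := hW.2 q
  grind

theorem IsOrderTriple.injective {X W Z X' W' Z' : Finset P} (h : IsOrderTriple r X W Z)
    (h' : IsOrderTriple r X' W' Z') (h1 : idealBelow r X = idealBelow r X')
    (h2 : middleIdeal r X W = middleIdeal r X' W') (h3 : idealUpTo r Z = idealUpTo r Z') :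
    X = X' ∧ W = W' ∧ Z = Z' := by
  obtain rfl := h.1.idealBelow_injective h'.1 h1
  obtain rfl := h.2.2.1.idealUpTo_injective h'.2.2.1 h3
  refine ⟨rfl, ?_, rfl⟩
  -- The two encodings of the middle ideal never collide: a collision forces `W'` onto the level of
  -- `X`, where it is either a proper subset of `X` or the full level, and the latter contains
  -- elements that `idealBelow r W` avoids.
  have key : ∀ W W', IsOrderTriple r X W Z → IsOrderTriple r X W' Z → W ⊂ X → ¬ W' ⊂ X →
      idealBelow r W ≠ idealUpTo r W' := by
    intro W W' hW hW' hWX hW'X he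
    obtain ⟨hX, hWl, hZ, hlt, -⟩ := hW
    obtain ⟨-, hWl', -, -, hW'⟩ := hW'
    have hrk := hX.rankOf_eq_of_subset hWl.1 hWX.1
    obtain ⟨x, hx, hxW⟩ := Finset.exists_of_ssubset hWX
    have hxr := hX.2 x hx
    obtain ⟨y, hy⟩ := hWl.1
    have hyr := hWl.2 y hy
    have m := fun p => Finset.ext_iff.1 he p
    simp only [mem_idealBelow, mem_idealUpTo] at m
    have mx := m x
    have my := m y
    obtain ⟨w, hw⟩ := hWl'.1
    have mw := m w
    have hwr := hWl'.2 w hw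
    have hxr' := hWl'.2 x
    have hrk' : rankOf r W' = rankOf r X := by grind
    rcases hW' with ⟨x', hx', rfl⟩ | ⟨z, hz, rfl⟩ | ⟨h1, h2, h3⟩ | ⟨h1, h2, h3, h4, h5⟩
    · exact hW'X (Finset.erase_ssubset hx')
    · have := hZ.rankOf_eq_of_subset hWl'.1 (Finset.erase_subset z Z)
      omega
    · omega
    · have : y ∈ W' := by rw [h1, mem_level]; omega
      grind
  simp only [middleIdeal] at h2
  split_ifs at h2 with c1 c2 c2
  · exact h.2.1.idealBelow_injective h'.2.1 h2
  · exact absurd h2 (key _ _ h h' c1 c2)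
  · exact absurd h2.symm (key _ _ h' h c2 c1)
  · exact h.2.1.idealUpTo_injective h'.2.1 h2

variable [PartialOrder P]

theorem isLowerSet_idealBelow (hr : ∀ p q : P, p < q ↔ r p < r q) (X : Finset P) :
    IsLowerSet (idealBelow r X : Set P) := by
  intro a b hba ha
  rcases hba.eq_or_lt with rfl | h
  · exact ha
  · have := (hr _ _).1 h
    rw [Finset.mem_coe, mem_idealBelow] at ha ⊢
    omega

theorem IsLevelSubset.isLowerSet_idealUpTo (hr : ∀ p q : P, p < q ↔ r p < r q) {X : Finset P}
    (hX : IsLevelSubset r X) : IsLowerSet (idealUpTo r X : Set P) := by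
  intro a b hba ha
  rcases hba.eq_or_lt with rfl | h
  · exact ha
  · have := (hr _ _).1 h
    rw [Finset.mem_coe, mem_idealUpTo] at ha ⊢
    have := hX.2 a
    grind

/-- `X` consists of the elements of least rank outside `I`. -/
theorem exists_eq_idealBelow (hr : ∀ p q : P, p < q ↔ r p < r q) {I : Finset P}
    (hI : IsLowerSet (I : Set P)) {p₀ : P} (hp₀ : p₀ ∉ I) :
    ∃ X, IsLevelSubset r X ∧ I = idealBelow r X := by
  obtain ⟨p, hp, hmin⟩ := Iᶜ.exists_min_image r ⟨p₀, by simp [hp₀]⟩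
  simp only [Finset.mem_compl] at hp hmin
  have hne : (Finset.univ.filter fun q => q ∉ I ∧ r q = r p).Nonempty := ⟨p, by simp [hp]⟩
  have hall : ∀ q ∈ Finset.univ.filter fun q => q ∉ I ∧ r q = r p, r q = r p := fun q hq =>
    (Finset.mem_filter.1 hq).2.2
  refine ⟨_, isLevelSubset_of hne hall, ?_⟩
  ext q
  rw [mem_idealBelow, rankOf_eq hne hall]
  simp only [Finset.mem_filter, Finset.mem_univ, true_and]
  have h1 := hmin q
  have h2 : q ∈ I → r q ≤ r p := fun h => not_lt.1 fun hlt => hp (hI ((hr _ _).2 hlt).le h)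
  grind

theorem exists_eq_idealUpTo (hr : ∀ p q : P, p < q ↔ r p < r q) {K : Finset P}
    (hK : IsLowerSet (K : Set P)) (hne : K.Nonempty) :
    ∃ Z, IsLevelSubset r Z ∧ K = idealUpTo r Z ∧ Z ⊆ K := by
  obtain ⟨p, hp, hmax⟩ := K.exists_max_image r hne
  have hne : (K.filter fun q => r q = r p).Nonempty := ⟨p, by simp [hp]⟩
  have hall : ∀ q ∈ K.filter fun q => r q = r p, r q = r p := fun q hq =>
    (Finset.mem_filter.1 hq).2
  refine ⟨_, isLevelSubset_of hne hall, ?_, Finset.filter_subset _ _⟩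
  ext q
  rw [mem_idealUpTo, rankOf_eq hne hall]
  simp only [Finset.mem_filter]
  have h1 := hmax q
  have h2 : r q < r p → q ∈ K := fun hlt => hK ((hr _ _).2 hlt).le hp
  grind

theorem isIdealEdge_below_upTo (hr : ∀ p q : P, p < q ↔ r p < r q) {X Z : Finset P}
    (hX : IsLevelSubset r X) (hZ : IsLevelSubset r Z) (h : rankOf r X < rankOf r Z) :
    IsIdealEdge (idealBelow r X) (idealUpTo r Z) := by
  obtain ⟨x, hx⟩ := hX.1
  obtain ⟨z, hz⟩ := hZ.1
  have h1 := hX.2 x hx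
  have h2 := hZ.2 z hz
  have hx1 : x ∉ idealBelow r X := by rw [mem_idealBelow]; grind
  have hx2 : x ∈ idealUpTo r Z := by rw [mem_idealUpTo]; omega
  have hz1 : z ∉ idealBelow r X := by rw [mem_idealBelow]; omega
  have hz2 : z ∈ idealUpTo r Z := by rw [mem_idealUpTo]; exact Or.inr hz
  refine ⟨isLowerSet_idealBelow hr X, hZ.isLowerSet_idealUpTo hr,
    (Finset.ssubset_iff_of_subset fun p hp => ?_).2 ⟨x, hx2, hx1⟩,
    Or.inr ⟨x, by simp [hx1, hx2], z, by simp [hz1, hz2], (hr _ _).2 (by omega)⟩⟩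
  rw [mem_idealBelow] at hp
  rw [mem_idealUpTo]
  omega

theorem isIdealEdge_insert {P : Type*} [PartialOrder P] [DecidableEq P] {I J : Finset P}
    (hI : IsLowerSet (I : Set P)) (hJ : IsLowerSet (J : Set P)) {s : P} (hs : s ∉ I) (h : J = insert s I) : IsIdealEdge I J :=
  ⟨hI, hJ, h ▸ Finset.ssubset_insert hs, Or.inl ⟨s, hs, h⟩⟩

theorem isIdealEdge_upTo_level (hr : ∀ p q : P, p < q ↔ r p < r q)
    (hsurj : ∀ (p : P) (n : ℕ), n < r p → ∃ q, r q = n) {W Z : Finset P}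
    (hW : IsLevelSubset r W) (hZ : IsLevelSubset r Z) (hfull : W = level r (rankOf r W))
    (h : rankOf r W < rankOf r Z) (hcard : rankOf r W + 1 = rankOf r Z → Z.card = 1) :
    IsIdealEdge (idealUpTo r W) (idealUpTo r Z) := by
  obtain ⟨z, hz⟩ := hZ.1
  have h2 := hZ.2 z hz
  have hWm : ∀ p, p ∈ W ↔ r p = rankOf r W := fun p => by
    conv_lhs => rw [hfull]
    exact mem_level
  have hsub : idealUpTo r W ⊆ idealUpTo r Z := fun p hp => by
    rw [mem_idealUpTo, hWm] at hp
    rw [mem_idealUpTo]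
    omega
  have hz1 : z ∉ idealUpTo r W := by rw [mem_idealUpTo, hWm]; omega
  have hz2 : z ∈ idealUpTo r Z := by rw [mem_idealUpTo]; exact Or.inr hz
  by_cases h1 : rankOf r W + 1 = rankOf r Z
  · obtain ⟨z', hz'⟩ := Finset.card_eq_one.1 (hcard h1)
    refine isIdealEdge_insert (hW.isLowerSet_idealUpTo hr) (hZ.isLowerSet_idealUpTo hr) hz1 ?_
    ext p
    rw [Finset.mem_insert, mem_idealUpTo, mem_idealUpTo, hWm]
    rw [hz', Finset.mem_singleton] at hz
    have : p ∈ Z ↔ p = z := by rw [hz', Finset.mem_singleton, hz]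
    rw [this]
    grind
  -- When a level is skipped, its elements lie in the difference below `z`, so the difference is
  -- connected whatever the size of `Z`.
  · obtain ⟨q, hq⟩ := hsurj z (rankOf r W + 1) (by omega)
    have hq1 : q ∉ idealUpTo r W := by rw [mem_idealUpTo, hWm]; omega
    have hq2 : q ∈ idealUpTo r Z := by rw [mem_idealUpTo]; omega
    exact ⟨hW.isLowerSet_idealUpTo hr, hZ.isLowerSet_idealUpTo hr,
      (Finset.ssubset_iff_of_subset hsub).2 ⟨z, hz2, hz1⟩,
      Or.inr ⟨q, by simp [hq1, hq2], z, by simp [hz1, hz2], (hr _ _).2 (by omega)⟩⟩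

theorem IsOrderTriple.idealEdges (hr : ∀ p q : P, p < q ↔ r p < r q)
    (hsurj : ∀ (p : P) (n : ℕ), n < r p → ∃ q, r q = n) {X W Z : Finset P}
    (h : IsOrderTriple r X W Z) :
    IsIdealEdge (idealBelow r X) (middleIdeal r X W) ∧
      IsIdealEdge (middleIdeal r X W) (idealUpTo r Z) ∧
      IsIdealEdge (idealBelow r X) (idealUpTo r Z) := by
  obtain ⟨hX, hW, hZ, hlt, h⟩ := h
  refine ⟨?_, ?_, isIdealEdge_below_upTo hr hX hZ hlt⟩
  all_goals
    rcases h with ⟨x, hx, rfl⟩ | ⟨z, hz, rfl⟩ | ⟨h1, h2, h3⟩ | ⟨h1, h2, h3, h4, h5⟩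
  · rw [middleIdeal, if_pos (Finset.erase_ssubset hx)]
    have hrk := hX.rankOf_eq_of_subset hW.1 (Finset.erase_subset x X)
    have hxr := hX.2 x hx
    refine isIdealEdge_insert (isLowerSet_idealBelow hr _) (isLowerSet_idealBelow hr _) (s := x) ?_ ?_
    · rw [mem_idealBelow]; grind
    · ext p
      rw [Finset.mem_insert, mem_idealBelow, mem_idealBelow, hrk, Finset.mem_erase]
      grind
  · have hrk := hZ.rankOf_eq_of_subset hW.1 (Finset.erase_subset z Z)
    rw [middleIdeal, if_neg fun h => by
      have := hX.rankOf_eq_of_subset hW.1 h.1; omega]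
    exact isIdealEdge_below_upTo hr hX hW (by omega)
  · rw [middleIdeal, if_neg fun h => by
      have := hX.rankOf_eq_of_subset hW.1 h.1; omega]
    exact isIdealEdge_below_upTo hr hX hW h1
  · have hns : ¬ W ⊂ X := fun h => by
      have h' := hX.rankOf_eq_of_subset hW.1 h.1
      have := hX.subset_level
      rw [← h', ← h1] at this
      exact h.2 this
    rw [middleIdeal, if_neg hns]
    by_cases hXW : rankOf r X = rankOf r W
    · obtain ⟨x, rfl⟩ := Finset.card_eq_one.1 (h4 hXW)
      have hWm : ∀ p, p ∈ W ↔ r p = rankOf r W := fun p => by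
        conv_lhs => rw [h1]
        exact mem_level
      have hxr := hX.2 x (by simp)
      refine isIdealEdge_insert (isLowerSet_idealBelow hr _) (hW.isLowerSet_idealUpTo hr)
        (s := x) ?_ ?_
      · rw [mem_idealBelow]; grind
      · ext p
        rw [Finset.mem_insert, mem_idealBelow, mem_idealUpTo, hWm]
        grind
    · exact isIdealEdge_below_upTo hr hX hW (by omega)
  · rw [middleIdeal, if_pos (Finset.erase_ssubset hx)]
    have hrk := hX.rankOf_eq_of_subset hW.1 (Finset.erase_subset x X)
    exact isIdealEdge_below_upTo hr hW hZ (by omega)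
  · have hrk := hZ.rankOf_eq_of_subset hW.1 (Finset.erase_subset z Z)
    rw [middleIdeal, if_neg fun h => by
      have := hX.rankOf_eq_of_subset hW.1 h.1; omega]
    have hzr := hZ.2 z hz
    refine isIdealEdge_insert (hW.isLowerSet_idealUpTo hr) (hZ.isLowerSet_idealUpTo hr) (s := z) ?_ ?_
    · rw [mem_idealUpTo]; grind
    · ext p
      rw [Finset.mem_insert, mem_idealUpTo, mem_idealUpTo, hrk, Finset.mem_erase]
      grind
  · rw [middleIdeal, if_neg fun h => by
      have := hX.rankOf_eq_of_subset hW.1 h.1; omega]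
    obtain ⟨h4, h5, h6⟩ := hW.sdiff h3
    rw [h6]
    exact isIdealEdge_below_upTo hr h4 hZ (by omega)
  · have hns : ¬ W ⊂ X := fun h => by
      have h' := hX.rankOf_eq_of_subset hW.1 h.1
      have := hX.subset_level
      rw [← h', ← h1] at this
      exact h.2 this
    rw [middleIdeal, if_neg hns]
    exact isIdealEdge_upTo_level hr hsurj hW hZ h1 h3 h5

/-- `X` is read off the lowest level missing from `I`, and `W`, `Z` off the top levels of `J` and
`K`. Only when `J` ends partway through the level of `X` is its top part replaced by the complement
in that level. -/
theorem exists_orderTriple (hr : ∀ p q : P, p < q ↔ r p < r q) {I J K : Finset P}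
    (hIJ : IsIdealEdge I J) (hJK : IsIdealEdge J K) (hIK : IsIdealEdge I K) :
    ∃ X W Z, IsOrderTriple r X W Z ∧ I = idealBelow r X ∧ J = middleIdeal r X W ∧
      K = idealUpTo r Z := by
  have s1 := hIJ.2.2.1
  have s2 := hJK.2.2.1
  obtain ⟨d, hdJ, hdI⟩ := Finset.exists_of_ssubset s1
  obtain ⟨e, heK, heJ⟩ := Finset.exists_of_ssubset s2
  obtain ⟨X, hX, hXI⟩ := exists_eq_idealBelow hr hIJ.1 hdI
  obtain ⟨Z, hZ, hZK, -⟩ := exists_eq_idealUpTo hr hJK.2.1 ⟨e, heK⟩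
  obtain ⟨W, hW, hWJ, hWJ'⟩ := exists_eq_idealUpTo hr hIJ.2.1 ⟨d, hdJ⟩
  have mI : ∀ p, p ∈ I ↔ r p < rankOf r X ∨ (r p = rankOf r X ∧ p ∉ X) := fun p => by
    rw [hXI, mem_idealBelow]
  have mJ : ∀ p, p ∈ J ↔ r p < rankOf r W ∨ p ∈ W := fun p => by rw [hWJ, mem_idealUpTo]
  have mK : ∀ p, p ∈ K ↔ r p < rankOf r Z ∨ p ∈ Z := fun p => by rw [hZK, mem_idealUpTo]
  have hle : ∀ p ∈ K \ I, rankOf r X ≤ r p ∧ r p ≤ rankOf r Z := fun p hp => by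
    have h1 := (mI p).not.1 (Finset.mem_sdiff.1 hp).2
    have h2 := (mK p).1 (Finset.mem_sdiff.1 hp).1
    have h3 := hZ.2 p
    grind
  have hlt : rankOf r X < rankOf r Z := by
    obtain ⟨-, -, -, ⟨s, hs, hK⟩ | ⟨p, hp, q, hq, hpq⟩⟩ := hIK
    · have := s2.1 hdJ
      grind
    · have := (hr _ _).1 hpq
      have := hle p hp
      have := hle q hq
      omega
  have hXW : rankOf r X ≤ rankOf r W := by
    have h1 := hle d (by simp [hdI, s2.1 hdJ])
    have h2 := (mJ d).1 hdJ
    have h3 := hW.2 d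
    grind
  have hWZ : rankOf r W ≤ rankOf r Z := by
    obtain ⟨w, hw⟩ := hW.1
    have h1 := (mK w).1 (s2.1 (hWJ' hw))
    have h2 := hZ.2 w
    have h3 := hW.2 w hw
    grind
  by_cases hfull : W = level r (rankOf r W)
  · have hWm : ∀ p, p ∈ W ↔ r p = rankOf r W := fun p => by
      conv_lhs => rw [hfull]
      exact mem_level
    have hns : ¬ W ⊂ X := fun h => by
      have h' := hX.rankOf_eq_of_subset hW.1 h.1
      have := hX.subset_level
      rw [← h', ← hfull] at this
      exact h.2 this
    have hWZ' : rankOf r W < rankOf r Z := by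
      refine lt_of_le_of_ne hWZ fun h => heJ ((mJ e).2 ?_)
      have h1 := (mK e).1 heK
      have h2 := hZ.2 e
      rw [hWm]
      grind
    refine ⟨X, W, Z, ⟨hX, hW, hZ, hlt, Or.inr (Or.inr (Or.inr
      ⟨hfull, hXW, hWZ', fun h => ?_, fun h => ?_⟩))⟩, hXI, ?_, hZK⟩
    -- The difference lies in a single level, so it has no comparable pair and must be a singleton.
    · have hdiff : J \ I = X := by
        ext p
        rw [Finset.mem_sdiff, mI, mJ, hWm]
        have := hX.2 p
        grind
      obtain ⟨-, -, -, ⟨s, hs, hJ⟩ | ⟨p, hp, q, hq, hpq⟩⟩ := hIJ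
      · rw [← hdiff, hJ, Finset.insert_sdiff_cancel hs, Finset.card_singleton]
      · rw [hdiff] at hp hq
        have := (hr _ _).1 hpq
        have := hX.2 p hp
        have := hX.2 q hq
        omega
    · have hdiff : K \ J = Z := by
        ext p
        rw [Finset.mem_sdiff, mK, mJ, hWm]
        have := hZ.2 p
        grind
      obtain ⟨-, -, -, ⟨s, hs, hJ⟩ | ⟨p, hp, q, hq, hpq⟩⟩ := hJK
      · rw [← hdiff, hJ, Finset.insert_sdiff_cancel hs, Finset.card_singleton]
      · rw [hdiff] at hp hq
        have := (hr _ _).1 hpq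
        have := hZ.2 p hp
        have := hZ.2 q hq
        omega
    · rw [middleIdeal, if_neg hns, hWJ]
  · by_cases h1 : rankOf r X = rankOf r W
    · obtain ⟨hV, hVr, hVJ⟩ := hW.sdiff hfull
      set V := level r (rankOf r W) \ W with hVdef
      have mJ' : ∀ p, p ∈ J ↔ r p < rankOf r V ∨ (r p = rankOf r V ∧ p ∉ V) := fun p => by
        rw [hWJ, hVJ, mem_idealBelow]
      have hVX : ∃ x ∈ X, V = X.erase x := by
        obtain ⟨-, -, -, ⟨s, hs, hJ⟩ | ⟨p, hp, q, hq, hpq⟩⟩ := hIJ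
        · have hm : ∀ p, p ∈ J ↔ p = s ∨ p ∈ I := fun p => by rw [hJ, Finset.mem_insert]
          refine ⟨s, ?_, ?_⟩
          · have h2 := (mI s).not.1 hs
            have h3 := (mJ' s).1 ((hm s).2 (Or.inl rfl))
            grind
          · ext p
            have h2 := mI p
            have h3 := mJ' p
            have h4 := hm p
            have h5 := hX.2 p
            have h6 := hV.2 p
            have h7 := mI s
            rw [Finset.mem_erase]
            grind
        · simp only [Finset.mem_sdiff, mI, mJ'] at hp hq
          have := (hr _ _).1 hpq
          omega
      obtain ⟨x, hx, hVx⟩ := hVX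
      refine ⟨X, V, Z, ⟨hX, hV, hZ, hlt, Or.inl ⟨x, hx, hVx⟩⟩, hXI, ?_, hZK⟩
      rw [middleIdeal, if_pos (hVx ▸ Finset.erase_ssubset hx), hWJ, hVJ]
    · have hns : ¬ W ⊂ X := fun h => h1 (hX.rankOf_eq_of_subset hW.1 h.1).symm
      refine ⟨X, W, Z, ⟨hX, hW, hZ, hlt, ?_⟩, hXI, by rw [middleIdeal, if_neg hns, hWJ], hZK⟩
      by_cases h2 : rankOf r W = rankOf r Z
      · refine Or.inr (Or.inl ?_)
        obtain ⟨-, -, -, ⟨s, hs, hJ⟩ | ⟨p, hp, q, hq, hpq⟩⟩ := hJK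
        · have hm : ∀ p, p ∈ K ↔ p = s ∨ p ∈ J := fun p => by rw [hJ, Finset.mem_insert]
          refine ⟨s, ?_, ?_⟩
          · have h2 := (mJ s).not.1 hs
            have h3 := (mK s).1 ((hm s).2 (Or.inl rfl))
            grind
          · ext p
            have h2 := mK p
            have h3 := mJ p
            have h4 := hm p
            have h5 := hZ.2 p
            have h6 := hW.2 p
            have h7 := mJ s
            rw [Finset.mem_erase]
            grind
        · simp only [Finset.mem_sdiff, mK, mJ] at hp hq
          have := (hr _ _).1 hpq
          have := hZ.2 p
          have := hZ.2 q
          grind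
      · exact Or.inr (Or.inr (Or.inl ⟨by omega, by omega, hfull⟩))

theorem encard_faceFamilies_lowerSets (hr : ∀ p q : P, p < q ↔ r p < r q)
    (hsurj : ∀ (p : P) (n : ℕ), n < r p → ∃ q, r q = n) :
    {T : Finset (Finset P) | T.card = 3 ∧
      IsFaceFamily {v : Finset P | IsLowerSet (v : Set P)} T}.encard =
    {t : Finset P × Finset P × Finset P | IsOrderTriple r t.1 t.2.1 t.2.2}.encard := by
  have hinj : Set.InjOn (fun t : Finset P × Finset P × Finset P =>
      ({idealBelow r t.1, middleIdeal r t.1 t.2.1, idealUpTo r t.2.2} : Finset (Finset P)))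
      {t | IsOrderTriple r t.1 t.2.1 t.2.2} := by
    rintro ⟨X, W, Z⟩ h ⟨X', W', Z'⟩ h' he
    have e := IsOrderTriple.idealEdges hr hsurj h
    have e' := IsOrderTriple.idealEdges hr hsurj h'
    have c : ∀ {I J : Finset P}, IsIdealEdge I J → I.card < J.card := fun h =>
      Finset.card_lt_card h.2.2.1
    obtain ⟨h1, h2, h3⟩ := triple_eq_of_lt (g := Finset.card) (k := Finset.card) he (c e.1) (c e.2.2)
      (c e'.1) (c e'.2.2) (c e.2.2) (c e.2.1) (c e'.2.2) (c e'.2.1)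
    obtain ⟨rfl, rfl, rfl⟩ := IsOrderTriple.injective h h' h1 h2 h3
    rfl
  rw [← hinj.encard_image]
  congr 1
  ext T
  constructor
  · rintro ⟨hc, hT⟩
    obtain ⟨I, J, K, rfl, h1, h2, h3⟩ := hT.exists_idealEdges hc
    obtain ⟨X, W, Z, h, rfl, rfl, rfl⟩ := exists_orderTriple hr h1 h2 h3
    exact ⟨(X, W, Z), h, rfl⟩
  · rintro ⟨⟨X, W, Z⟩, h, rfl⟩
    obtain ⟨h1, h2, h3⟩ := IsOrderTriple.idealEdges hr hsurj h
    refine ⟨Finset.card_eq_three.2 ⟨_, _, _, h1.2.2.1.ne, h3.2.2.1.ne, h2.2.2.1.ne, rfl⟩,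
      isFaceFamily_of_idealEdges hr h1 h2 h3⟩

end Level

/-! ### Triangles of the chain polytope as triples of antichains -/

/-- The triples which index the triangular faces of the chain polytope. -/
def IsChainTriple {P : Type*} [DecidableEq P] (r : P → ℕ) (X W Z : Finset P) : Prop :=
  IsLevelSubset r X ∧ IsLevelSubset r Z ∧ rankOf r X < rankOf r Z ∧
    -- Nonemptiness matters: the empty set belongs to every level, so it may join `X` and `Z` only
    -- if both are singletons. That is the last case.
    ((W.Nonempty ∧ ∃ x ∈ X, W = X.erase x) ∨ (W.Nonempty ∧ ∃ z ∈ Z, W = Z.erase z) ∨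
      (IsLevelSubset r W ∧ rankOf r X < rankOf r W ∧ rankOf r W < rankOf r Z) ∨
      (W = ∅ ∧ X.card = 1 ∧ Z.card = 1))

/-- A key for which the first member of a chain triple is the least one. -/
def lowKey {P : Type*} [DecidableEq P] (r : P → ℕ) (v : Finset P) : ℕ ×ₗ (ℕ ×ₗ ℤ) :=
  -- The flag keeps `∅`, whose `rankOf` is `0`, from coming first; the sign of the cardinality puts
  -- `X` before `X.erase x`.
  toLex (if v = ∅ then 1 else 0, toLex (rankOf r v, -(v.card : ℤ)))

/-- A key for which the last member of a chain triple is the greatest one. -/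
def highKey {P : Type*} (r : P → ℕ) (v : Finset P) : ℕ ×ₗ ℕ := toLex (rankOf r v, v.card)

section Chain

variable {P : Type*} [PartialOrder P] {r : P → ℕ}

theorem IsLevelSubset.isAntichain (hr : ∀ p q : P, p < q ↔ r p < r q) {X : Finset P}
    (hX : IsLevelSubset r X) : IsAntichain (· ≤ ·) (X : Set P) := by
  intro a ha b hb hab hle
  have := (hr _ _).1 (lt_of_le_of_ne hle hab)
  have := hX.2 a ha
  have := hX.2 b hb
  omega

theorem isLevelSubset_of_isAntichain (hr : ∀ p q : P, p < q ↔ r p < r q) {X : Finset P}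
    (hX : IsAntichain (· ≤ ·) (X : Set P)) (hne : X.Nonempty) : IsLevelSubset r X := by
  obtain ⟨x, hx⟩ := hne
  refine isLevelSubset_of ⟨x, hx⟩ (n := r x) fun p hp => ?_
  rcases lt_trichotomy (r p) (r x) with h | h | h
  · have h' := (hr _ _).2 h
    exact absurd h'.le (hX hp hx h'.ne)
  · exact h
  · have h' := (hr _ _).2 h
    exact absurd h'.le (hX hx hp h'.ne)

variable [DecidableEq P]

-- Every subset of a level is an antichain, so any element of the symmetric difference can be
-- toggled. The rank conditions are vacuous for `∅`, which therefore fits every level.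
open scoped symmDiff in
theorem IsFaceFamily.exists_eq_erase (hr : ∀ p q : P, p < q ↔ r p < r q)
    {T : Finset (Finset P)} (hT : IsFaceFamily {v : Finset P | IsAntichain (· ≤ ·) (v : Set P)} T)
    (hc : T.card = 3) {A B : Finset P} (hA : A ∈ T) (hB : B ∈ T) (hAB : A ≠ B)
    (hcard : A.card ≤ B.card) {n : ℕ} (hAn : ∀ p ∈ A, r p = n) (hBn : ∀ p ∈ B, r p = n) :
    ∃ b ∈ B, A = B.erase b := by
  have hanti : ∀ v : Finset P, (∀ p ∈ v, r p = n) → IsAntichain (· ≤ ·) (v : Set P) := by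
    intro v hv a ha b hb hab hle
    have := (hr _ _).1 (lt_of_le_of_ne hle hab)
    have := hv a ha
    have := hv b hb
    omega
  obtain ⟨s, hs⟩ : (A ∆ B).Nonempty := by
    rw [Finset.nonempty_iff_ne_empty]
    exact fun h => hAB (symmDiff_eq_bot.1 h)
  have hsn : r s = n := by
    rcases Finset.mem_symmDiff.1 hs with h | h
    exacts [hAn s h.1, hBn s h.1]
  have h := hT.symmDiff_eq_singleton hc hA hB hs
    (hanti _ fun p hp => by
      rcases Finset.mem_symmDiff.1 hp with h | h
      · exact hAn p h.1
      · rw [Finset.mem_singleton.1 h.1, hsn])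
    (hanti _ fun p hp => by
      rcases Finset.mem_symmDiff.1 hp with h | h
      · exact hBn p h.1
      · rw [Finset.mem_singleton.1 h.1, hsn])
  have hm : ∀ p, (p ∈ A ∧ p ∉ B ∨ p ∈ B ∧ p ∉ A) ↔ p = s := fun p => by
    rw [← Finset.mem_symmDiff, h, Finset.mem_singleton]
  by_cases hsB : s ∈ B
  · refine ⟨s, hsB, ?_⟩
    ext p
    have := hm p
    have := hm s
    rw [Finset.mem_erase]
    grind
  · exfalso
    have hBA : B ⊂ A := by
      refine (Finset.ssubset_iff_of_subset fun p hp => ?_).2 ⟨s, ?_, hsB⟩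
      · have := hm p
        grind
      · have := hm s
        grind
    exact absurd (Finset.card_lt_card hBA) (not_lt.2 hcard)

theorem exists_chainTriple (hr : ∀ p q : P, p < q ↔ r p < r q)
    {T : Finset (Finset P)} (hT : IsFaceFamily {v : Finset P | IsAntichain (· ≤ ·) (v : Set P)} T)
    (hc : T.card = 3) : ∃ X W Z, IsChainTriple r X W Z ∧ T = {X, W, Z} := by
  obtain ⟨A, B, C, hTe, hAB, hAC, hBC, h1, h2⟩ :=
    exists_sorted_triple hc fun v : Finset P => toLex (rankOf r v, v.card)
  have hA : A ∈ T := by simp [hTe]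
  have hB : B ∈ T := by simp [hTe]
  have hC : C ∈ T := by simp [hTe]
  have hlex : ∀ u v : Finset P, toLex (rankOf r u, u.card) ≤ toLex (rankOf r v, v.card) →
      rankOf r u ≤ rankOf r v ∧ (rankOf r u = rankOf r v → u.card ≤ v.card) := by
    intro u v h
    rw [Prod.Lex.toLex_le_toLex] at h
    grind
  have h3 := hlex _ _ (h1.trans h2)
  replace h1 := hlex _ _ h1
  replace h2 := hlex _ _ h2
  -- Having rank and cardinality `0`, the empty set can only come first in the sorted triple.
  have hrk0 : rankOf r (∅ : Finset P) = 0 := rfl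
  have hBne : B.Nonempty := by
    rw [Finset.nonempty_iff_ne_empty]
    rintro rfl
    rw [hrk0, Finset.card_empty] at h1
    exact hAB (Finset.card_eq_zero.1 (Nat.le_zero.1 (h1.2 (Nat.le_zero.1 h1.1))))
  have hCne : C.Nonempty := by
    rw [Finset.nonempty_iff_ne_empty]
    rintro rfl
    rw [hrk0, Finset.card_empty] at h3
    exact hAC (Finset.card_eq_zero.1 (Nat.le_zero.1 (h3.2 (Nat.le_zero.1 h3.1))))
  have hBl := isLevelSubset_of_isAntichain hr (hT.1 hB) hBne
  have hCl := isLevelSubset_of_isAntichain hr (hT.1 hC) hCne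
  have hBCe : rankOf r B = rankOf r C → ∃ c ∈ C, B = C.erase c := fun h =>
    hT.exists_eq_erase hr hc hB hC hBC (h2.2 h) hBl.2 (h ▸ hCl.2)
  rcases A.eq_empty_or_nonempty with rfl | hAne
  · obtain ⟨b, hb, hBb⟩ := hT.exists_eq_erase hr hc hA hB hAB (by simp) (by simp) hBl.2
    obtain ⟨c, hc', hCc⟩ := hT.exists_eq_erase hr hc hA hC hAC (by simp) (by simp) hCl.2
    have hBcard : B.card = 1 := by
      have := Finset.card_erase_add_one hb
      rw [← hBb] at this
      simpa using this.symm
    have hCcard : C.card = 1 := by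
      have := Finset.card_erase_add_one hc'
      rw [← hCc] at this
      simpa using this.symm
    refine ⟨B, ∅, C, ⟨hBl, hCl, lt_of_le_of_ne h2.1 fun h => ?_, Or.inr (Or.inr (Or.inr
      ⟨rfl, hBcard, hCcard⟩))⟩, by rw [hTe, Finset.insert_comm]⟩
    obtain ⟨c', hcc, he⟩ := hBCe h
    have := Finset.card_erase_add_one hcc
    rw [← he] at this
    omega
  · have hAl := isLevelSubset_of_isAntichain hr (hT.1 hA) hAne
    by_cases h12 : rankOf r A = rankOf r B
    · obtain ⟨b, hb, hAb⟩ := hT.exists_eq_erase hr hc hA hB hAB (h1.2 h12) hAl.2 (h12 ▸ hBl.2)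
      by_cases h23 : rankOf r B = rankOf r C
      -- Three members on one level would differ pairwise by one in cardinality, which is
      -- impossible.
      · exfalso
        obtain ⟨c, hc1, hBc⟩ := hBCe h23
        obtain ⟨c', hc2, hAc⟩ := hT.exists_eq_erase hr hc hA hC hAC (h3.2 (h12.trans h23)) hAl.2
          (h12.trans h23 ▸ hCl.2)
        have e1 := Finset.card_erase_add_one hb
        have e2 := Finset.card_erase_add_one hc1
        have e3 := Finset.card_erase_add_one hc2
        rw [← hAb] at e1
        rw [← hBc] at e2
        rw [← hAc] at e3
        omega
      · exact ⟨B, A, C, ⟨hBl, hCl, lt_of_le_of_ne h2.1 h23, Or.inl ⟨hAne, b, hb, hAb⟩⟩, by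
          rw [hTe, Finset.insert_comm]⟩
    · by_cases h23 : rankOf r B = rankOf r C
      · exact ⟨A, B, C, ⟨hAl, hCl, by omega, Or.inr (Or.inl ⟨hBne, hBCe h23⟩)⟩, hTe⟩
      · exact ⟨A, B, C, ⟨hAl, hCl, by omega, Or.inr (Or.inr (Or.inl ⟨hBl, by omega, by omega⟩))⟩,
          hTe⟩

theorem isChain_triple (hr : ∀ p q : P, p < q ↔ r p < r q) {a b c : P} (hab : r a < r b)
    (hbc : r b < r c) : IsChain (· ≤ ·) (({a, b, c} : Finset P) : Set P) := by
  have h1 := ((hr _ _).2 hab).le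
  have h2 := ((hr _ _).2 hbc).le
  intro x hx y hy _
  simp only [Finset.coe_insert, Finset.coe_singleton, Set.mem_insert_iff,
    Set.mem_singleton_iff] at hx hy
  rcases hx with rfl | rfl | rfl <;> rcases hy with rfl | rfl | rfl <;>
    simp [h1, h2, h1.trans h2]

theorem isChain_pair (hr : ∀ p q : P, p < q ↔ r p < r q) {a b : P} (hab : r a < r b) :
    IsChain (· ≤ ·) (({a, b} : Finset P) : Set P) := by
  have h1 := ((hr _ _).2 hab).le
  intro x hx y hy _
  simp only [Finset.coe_insert, Finset.coe_singleton, Set.mem_insert_iff,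
    Set.mem_singleton_iff] at hx hy
  rcases hx with rfl | rfl <;> rcases hy with rfl | rfl <;> simp [h1]

theorem IsChainTriple.pairwise_ne {P : Type*} [DecidableEq P] {r : P → ℕ} {X W Z : Finset P}
    (h : IsChainTriple r X W Z) :
    X ≠ W ∧ X ≠ Z ∧ W ≠ Z := by
  obtain ⟨hX, hZ, hlt, h⟩ := h
  refine ⟨?_, fun e => by rw [e] at hlt; exact lt_irrefl _ hlt, ?_⟩
  all_goals rcases h with ⟨hne, x, hx, rfl⟩ | ⟨hne, z, hz, rfl⟩ | ⟨hW, h1, h2⟩ | ⟨rfl, h1, h2⟩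
  · exact (Finset.erase_ssubset hx).ne'
  · intro e; have := hZ.rankOf_eq_of_subset hne (Finset.erase_subset z Z); rw [← e] at this; omega
  · rintro rfl; exact lt_irrefl _ h1
  · rintro rfl; simp at h1
  · intro e; have := hX.rankOf_eq_of_subset hne (Finset.erase_subset x X); rw [e] at this; omega
  · exact (Finset.erase_ssubset hz).ne
  · rintro rfl; exact lt_irrefl _ h2
  · rintro rfl; simp at h2

theorem IsChainTriple.isFaceFamily [Finite P] (hr : ∀ p q : P, p < q ↔ r p < r q)
    {X W Z : Finset P} (h : IsChainTriple r X W Z) :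
    IsFaceFamily {v : Finset P | IsAntichain (· ≤ ·) (v : Set P)} {X, W, Z} := by
  obtain ⟨hX, hZ, hlt, h⟩ := h
  have hWa : IsAntichain (· ≤ ·) (W : Set P) := by
    rcases h with ⟨hne, x, hx, rfl⟩ | ⟨hne, z, hz, rfl⟩ | ⟨hW, h1, h2⟩ | ⟨rfl, h1, h2⟩
    · exact (hX.isAntichain hr).subset (Finset.coe_subset.2 (Finset.erase_subset _ _))
    · exact (hZ.isAntichain hr).subset (Finset.coe_subset.2 (Finset.erase_subset _ _))
    · exact hW.isAntichain hr
    · simp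
  refine isFaceFamily_of_separated ?_ fun v hv hvT => ?_
  · intro t ht
    simp only [Finset.coe_insert, Finset.coe_singleton, Set.mem_insert_iff,
      Set.mem_singleton_iff] at ht
    rcases ht with rfl | rfl | rfl
    exacts [hX.isAntichain hr, hWa, hZ.isAntichain hr]
  by_contra hcon
  have hsep : ∀ (w : P → ℝ) (c : ℝ),
      (∀ u : Finset P, IsAntichain (· ≤ ·) (u : Set P) → ∑ p ∈ u, w p ≤ c) →
      ∑ p ∈ X, w p = c → ∑ p ∈ W, w p = c → ∑ p ∈ Z, w p = c → c ≤ ∑ p ∈ v, w p := by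
    intro w c h1 h2 h3 h4
    by_contra hlt
    exact hcon ⟨w, c, h1, by simp [h2, h3, h4], not_le.1 hlt⟩
  have hsub : ∀ p ∈ v, p ∈ X ∨ p ∈ W ∨ p ∈ Z := fun p hp => by
    by_contra hpK
    push Not at hpK
    have := hsep (fun q => if q = p then -1 else 0) 0 (fun u _ => by
      simp only [Finset.sum_ite_eq']; split_ifs <;> simp) (by simp [hpK.1]) (by simp [hpK.2.1])
      (by simp [hpK.2.2])
    norm_num [Finset.sum_ite_eq', hp] at this
  -- The chain inequality of `s` is valid, and tight on `X`, `W`, `Z` if each meets `s` once. An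
  -- antichain `v` that cannot be separated must then meet `s`.
  have hmeet : ∀ s : Finset P, IsChain (· ≤ ·) (s : Set P) → (X ∩ s).card = 1 → (W ∩ s).card = 1 →
      (Z ∩ s).card = 1 → ∃ p ∈ s, p ∈ v := fun s hs h1 h2 h3 => by
    have hsum : ∀ u : Finset P, ∑ p ∈ u, (if p ∈ s then (1 : ℝ) else 0) = ((u ∩ s).card : ℝ) :=
      fun u => by simp
    have := hsep (fun p => if p ∈ s then 1 else 0) 1 (fun u hu => by
      rw [hsum]
      have : (u ∩ s).card ≤ 1 := by
        rw [Finset.card_le_one]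
        intro a ha b hb
        simp only [Finset.mem_inter] at ha hb
        by_contra hab
        rcases hs ha.2 hb.2 hab with h | h
        · exact hu ha.1 hb.1 hab h
        · exact hu hb.1 ha.1 (Ne.symm hab) h
      exact_mod_cast this) (by rw [hsum, h1]; simp) (by rw [hsum, h2]; simp)
      (by rw [hsum, h3]; simp)
    rw [hsum] at this
    have h1 : 0 < (v ∩ s).card := by
      have : (1 : ℝ) ≤ ((v ∩ s).card : ℝ) := this
      exact_mod_cast this
    obtain ⟨p, hp⟩ := Finset.card_pos.1 h1
    exact ⟨p, (Finset.mem_inter.1 hp).2, (Finset.mem_inter.1 hp).1⟩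
  have hlev : ∀ p ∈ v, ∀ q ∈ v, r p = r q := fun p hp q hq => by
    have h := isLevelSubset_of_isAntichain hr hv ⟨p, hp⟩
    rw [h.2 p hp, h.2 q hq]
  have hXr := hX.2
  have hZr := hZ.2
  apply hvT
  simp only [Finset.mem_insert, Finset.mem_singleton]
  rcases h with ⟨hne, x, hx, rfl⟩ | ⟨hne, z, hz, rfl⟩ | ⟨hW, h1, h2⟩ | ⟨rfl, h1, h2⟩
  · have key : ∀ a ∈ X.erase x, ∀ b ∈ Z, a ∈ v ∨ b ∈ v := by
      intro a ha b hb
      have ha' := Finset.mem_of_mem_erase ha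
      have hab : r a < r b := by rw [hXr a ha', hZr b hb]; exact hlt
      have haZ : a ∉ Z := fun h => by have := hZr a h; have := hZr b hb; omega
      have hbX : b ∉ X := fun h => by have := hXr b h; have := hXr a ha'; omega
      obtain ⟨p, hp, hpv⟩ := hmeet {a, b} (isChain_pair hr hab)
        (Finset.card_eq_one.2 ⟨a, by ext p; grind⟩) (Finset.card_eq_one.2 ⟨a, by ext p; grind⟩)
        (Finset.card_eq_one.2 ⟨b, by ext p; grind⟩)
      grind
    obtain ⟨a, ha⟩ := hne
    have har := hXr a (Finset.mem_of_mem_erase ha)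
    by_cases hz : ∃ z ∈ v, z ∈ Z
    · obtain ⟨z, hzv, hzZ⟩ := hz
      right; right
      have hav : a ∉ v := fun h => by have := hlev a h z hzv; have := hZr z hzZ; omega
      ext p
      refine ⟨fun hp => ?_, fun hp => (key a ha p hp).resolve_left hav⟩
      have hpX : p ∉ X := fun h => by
        have := hlev p hp z hzv; have := hZr z hzZ; have := hXr p h; omega
      grind
    · obtain ⟨b, hb⟩ := hZ.1
      by_cases hxv : x ∈ v
      · left; ext p; grind
      · right; left; ext p; grind
  · have key : ∀ a ∈ X, ∀ b ∈ Z.erase z, a ∈ v ∨ b ∈ v := by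
      intro a ha b hb
      have hb' := Finset.mem_of_mem_erase hb
      have hab : r a < r b := by rw [hXr a ha, hZr b hb']; exact hlt
      have haZ : a ∉ Z := fun h => by have := hZr a h; have := hZr b hb'; omega
      have hbX : b ∉ X := fun h => by have := hXr b h; have := hXr a ha; omega
      obtain ⟨p, hp, hpv⟩ := hmeet {a, b} (isChain_pair hr hab)
        (Finset.card_eq_one.2 ⟨a, by ext p; grind⟩) (Finset.card_eq_one.2 ⟨b, by ext p; grind⟩)
        (Finset.card_eq_one.2 ⟨b, by ext p; grind⟩)
      grind
    obtain ⟨b, hb⟩ := hne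
    have hbr := hZr b (Finset.mem_of_mem_erase hb)
    by_cases hx : ∃ x ∈ v, x ∈ X
    · obtain ⟨x, hxv, hxX⟩ := hx
      left
      have hbv : b ∉ v := fun h => by have := hlev b h x hxv; have := hXr x hxX; omega
      ext p
      refine ⟨fun hp => ?_, fun hp => (key p hp b hb).resolve_right hbv⟩
      have hpZ : p ∉ Z := fun h => by
        have := hlev p hp x hxv; have := hXr x hxX; have := hZr p h; omega
      grind
    · obtain ⟨a, ha⟩ := hX.1
      by_cases hzv : z ∈ v
      · right; right; ext p; grind
      · right; left; ext p; grind
  · have hWr := hW.2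
    have key : ∀ a ∈ X, ∀ b ∈ W, ∀ c ∈ Z, a ∈ v ∨ b ∈ v ∨ c ∈ v := by
      intro a ha b hb c hc
      have hra := hXr a ha
      have hrb := hWr b hb
      have hrc := hZr c hc
      have haX := hXr b
      have haX' := hXr c
      have haW := hWr a
      have haW' := hWr c
      have haZ := hZr a
      have haZ' := hZr b
      obtain ⟨p, hp, hpv⟩ := hmeet {a, b, c} (isChain_triple hr (by omega) (by omega))
        (Finset.card_eq_one.2 ⟨a, by ext p; grind⟩) (Finset.card_eq_one.2 ⟨b, by ext p; grind⟩)
        (Finset.card_eq_one.2 ⟨c, by ext p; grind⟩)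
      grind
    obtain ⟨a, ha⟩ := hX.1
    obtain ⟨b, hb⟩ := hW.1
    obtain ⟨c, hc⟩ := hZ.1
    obtain ⟨e, hev⟩ : ∃ e, e ∈ v := by
      rcases key a ha b hb c hc with h | h | h <;> exact ⟨_, h⟩
    have hel := fun p hp => hlev p hp e hev
    have hra := hXr a ha
    have hrb := hWr b hb
    have hrc := hZr c hc
    have hla := hel a
    have hlb := hel b
    have hlc := hel c
    rcases hsub e hev with he | he | he
    · have := hXr e he
      left; ext p
      have := hel p
      have := hXr p
      have := hWr p
      have := hZr p
      have := hsub p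
      have := fun hp => key p hp b hb c hc
      grind
    · have := hWr e he
      right; left; ext p
      have := hel p
      have := hXr p
      have := hWr p
      have := hZr p
      have := hsub p
      have := fun hp => key a ha p hp c hc
      grind
    · have := hZr e he
      right; right; ext p
      have := hel p
      have := hXr p
      have := hWr p
      have := hZr p
      have := hsub p
      have := fun hp => key a ha b hb p hp
      grind
  · obtain ⟨a, rfl⟩ := Finset.card_eq_one.1 h1
    obtain ⟨b, rfl⟩ := Finset.card_eq_one.1 h2
    have hra := hXr a (by simp)
    have hrb := hZr b (by simp)
    have hab := hlev a
    by_cases hav : a ∈ v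
    · left; ext p; grind
    · by_cases hbv : b ∈ v
      · right; right; ext p; grind
      · right; left; ext p; grind

theorem IsChainTriple.lt_keys {P : Type*} [DecidableEq P] {r : P → ℕ} {X W Z : Finset P}
    (h : IsChainTriple r X W Z) :
    (lowKey r X < lowKey r W ∧ lowKey r X < lowKey r Z) ∧
      highKey r X < highKey r Z ∧ highKey r W < highKey r Z := by
  obtain ⟨hX, hZ, hlt, h⟩ := h
  have hXe := hX.1.ne_empty
  have hZe := hZ.1.ne_empty
  simp only [lowKey, highKey, Prod.Lex.toLex_lt_toLex, if_neg hXe, if_neg hZe, lt_self_iff_false,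
    true_and, false_or]
  rcases h with ⟨hne, x, hx, rfl⟩ | ⟨hne, z, hz, rfl⟩ | ⟨hW, h1, h2⟩ | ⟨rfl, h1, h2⟩
  · have hrk := hX.rankOf_eq_of_subset hne (Finset.erase_subset x X)
    have hcd := Finset.card_erase_add_one hx
    simp only [if_neg hne.ne_empty, lt_self_iff_false, true_and, false_or]
    omega
  · have hrk := hZ.rankOf_eq_of_subset hne (Finset.erase_subset z Z)
    have hcd := Finset.card_erase_add_one hz
    simp only [if_neg hne.ne_empty, lt_self_iff_false, true_and, false_or]
    omega
  · simp only [if_neg hW.1.ne_empty, lt_self_iff_false, true_and, false_or]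
    omega
  · have : rankOf r (∅ : Finset P) = 0 := rfl
    simp only [if_true, zero_lt_one, true_or, true_and]
    omega

theorem encard_faceFamilies_antichains [Finite P] (hr : ∀ p q : P, p < q ↔ r p < r q) :
    {T : Finset (Finset P) | T.card = 3 ∧
      IsFaceFamily {v : Finset P | IsAntichain (· ≤ ·) (v : Set P)} T}.encard =
    {t : Finset P × Finset P × Finset P | IsChainTriple r t.1 t.2.1 t.2.2}.encard := by
  have hinj : Set.InjOn (fun t : Finset P × Finset P × Finset P =>
      ({t.1, t.2.1, t.2.2} : Finset (Finset P)))
      {t | IsChainTriple r t.1 t.2.1 t.2.2} := by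
    rintro ⟨X, W, Z⟩ h ⟨X', W', Z'⟩ h' he
    have e := IsChainTriple.lt_keys h
    have e' := IsChainTriple.lt_keys h'
    obtain ⟨h1, h2, h3⟩ := triple_eq_of_lt (g := lowKey r) (k := highKey r) he
      e.1.1 e.1.2 e'.1.1 e'.1.2 e.2.1 e.2.2 e'.2.1 e'.2.2
    exact Prod.ext h1 (Prod.ext h2 h3)
  rw [← hinj.encard_image]
  congr 1
  ext T
  constructor
  · rintro ⟨hc, hT⟩
    obtain ⟨X, W, Z, h, rfl⟩ := exists_chainTriple hr hT hc
    exact ⟨(X, W, Z), h, rfl⟩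
  · rintro ⟨⟨X, W, Z⟩, h, rfl⟩
    obtain ⟨h1, h2, h3⟩ := IsChainTriple.pairwise_ne h
    exact ⟨Finset.card_eq_three.2 ⟨_, _, _, h1, h2, h3, rfl⟩, IsChainTriple.isFaceFamily hr h⟩

end Chain

/-! ### Comparing order triples with chain triples -/

/-- The comparison map from order triples to chain triples. -/
def comparison {P : Type*} [Fintype P] [DecidableEq P] (r : P → ℕ)
    (t : Finset P × Finset P × Finset P) : Finset P × Finset P × Finset P :=
  -- An order triple fails to be a chain triple only if its middle is the full level of `X`. Its new
  -- middle is the one that order triples with the same `Z` cannot have: `∅` if `Z` is a singleton,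
  -- otherwise the level just below `Z`.
  (t.1, if t.2.1 = level r (rankOf r t.1) then
    (if t.2.2.card = 1 then ∅ else level r (rankOf r t.2.2 - 1)) else t.2.1, t.2.2)

theorem level_nonempty {P : Type*} [Fintype P] {r : P → ℕ}
    (hsurj : ∀ (p : P) (n : ℕ), n < r p → ∃ q, r q = n) {Z : Finset P}
    (hZ : IsLevelSubset r Z) {n : ℕ} (hn : n < rankOf r Z) : (level r n).Nonempty := by
  obtain ⟨z, hz⟩ := hZ.1
  obtain ⟨q, hq⟩ := hsurj z n (by rw [hZ.2 z hz]; exact hn)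
  exact ⟨q, mem_level.2 hq⟩

theorem isLevelSubset_level {P : Type*} [Fintype P] {r : P → ℕ} {n : ℕ} (h : (level r n).Nonempty) :
    IsLevelSubset r (level r n) ∧ rankOf r (level r n) = n :=
  ⟨isLevelSubset_of h fun _ => mem_level.1, rankOf_eq h fun _ => mem_level.1⟩

section Comparison

variable {P : Type*} [Fintype P] [DecidableEq P] {r : P → ℕ}

/-- Only the last type of order triples has a full level in the middle. -/
theorem IsOrderTriple.of_eq_level {X W Z : Finset P} (h : IsOrderTriple r X W Z) {n : ℕ}
    (hn : W = level r n) : rankOf r W = n ∧ rankOf r X ≤ n ∧ n < rankOf r Z ∧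
      (rankOf r X = n → X.card = 1) ∧ (n + 1 = rankOf r Z → Z.card = 1) := by
  obtain ⟨hX, hW, hZ, hlt, h⟩ := h
  have hrk : rankOf r W = n := rankOf_eq hW.1 fun p hp => mem_level.1 (hn ▸ hp)
  have hm : ∀ p, p ∈ W ↔ r p = n := fun p => by rw [hn, mem_level]
  refine ⟨hrk, ?_⟩
  rcases h with ⟨x, hx, hWx⟩ | ⟨z, hz, hWz⟩ | ⟨h1, h2, h3⟩ | ⟨h1, h2, h3, h4, h5⟩
  · have h1 := hX.rankOf_eq_of_subset hW.1 (hWx ▸ Finset.erase_subset x X)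
    have h2 : x ∈ W := by rw [hm, hX.2 x hx]; omega
    simp [hWx] at h2
  · have h1 := hZ.rankOf_eq_of_subset hW.1 (hWz ▸ Finset.erase_subset z Z)
    have h2 : z ∈ W := by rw [hm, hZ.2 z hz]; omega
    simp [hWz] at h2
  · rw [hrk] at h3
    exact absurd hn h3
  · rw [hrk] at h2 h3 h4 h5
    exact ⟨h2, h3, h4, h5⟩

theorem mapsTo_comparison (hsurj : ∀ (p : P) (n : ℕ), n < r p → ∃ q, r q = n) :
    Set.MapsTo (comparison r) {t | IsOrderTriple r t.1 t.2.1 t.2.2}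
      {t | IsChainTriple r t.1 t.2.1 t.2.2} := by
  rintro ⟨X, W, Z⟩ h
  change IsOrderTriple r X W Z at h
  change IsChainTriple r X (if W = level r (rankOf r X) then
    (if Z.card = 1 then ∅ else level r (rankOf r Z - 1)) else W) Z
  obtain ⟨hX, hW, hZ, hlt, h'⟩ := id h
  refine ⟨hX, hZ, hlt, ?_⟩
  split_ifs with h1 h2
  · exact Or.inr (Or.inr (Or.inr ⟨rfl, (h.of_eq_level h1).2.2.2.1 rfl, h2⟩))
  · have h3 := h.of_eq_level h1
    -- As `Z` is not a singleton, the level just below it is strictly above that of `X`.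
    have h4 : rankOf r X + 1 ≠ rankOf r Z := fun e => h2 (h3.2.2.2.2 e)
    obtain ⟨h5, h6⟩ := isLevelSubset_level
      (level_nonempty hsurj hZ (n := rankOf r Z - 1) (by omega))
    exact Or.inr (Or.inr (Or.inl ⟨h5, by omega, by omega⟩))
  · rcases h' with h' | h' | ⟨h2, h3, h4⟩ | ⟨h2, h3, h4, h5, h6⟩
    · exact Or.inl ⟨hW.1, h'⟩
    · exact Or.inr (Or.inl ⟨hW.1, h'⟩)
    · exact Or.inr (Or.inr (Or.inl ⟨hW, h2, h3⟩))
    · refine Or.inr (Or.inr (Or.inl ⟨hW, lt_of_le_of_ne h3 fun e => h1 ?_, h4⟩))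
      rw [e]
      exact h2

theorem injOn_comparison :
    Set.InjOn (comparison r) {t | IsOrderTriple r t.1 t.2.1 t.2.2} := by
  have key : ∀ X W W' Z : Finset P, IsOrderTriple r X W Z → IsOrderTriple r X W' Z →
      W = level r (rankOf r X) → W' ≠ (if Z.card = 1 then ∅ else level r (rankOf r Z - 1)) := by
    intro X W W' Z h h' h1 h2
    have h3 := h.2.2.2.1
    split_ifs at h2 with h4
    · exact h'.2.1.1.ne_empty h2
    · exact h4 ((h'.of_eq_level h2).2.2.2.2 (by omega))
  rintro ⟨X, W, Z⟩ h ⟨X', W', Z'⟩ h' he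
  simp only [comparison, Prod.mk.injEq] at he
  obtain ⟨rfl, he, rfl⟩ := he
  change IsOrderTriple r X W Z at h
  change IsOrderTriple r X W' Z at h'
  by_cases h1 : W = level r (rankOf r X) <;> by_cases h2 : W' = level r (rankOf r X)
  · rw [h1, h2]
  · rw [if_pos h1, if_neg h2] at he
    exact absurd he.symm (key _ _ _ _ h h' h1)
  · rw [if_neg h1, if_pos h2] at he
    exact absurd he (key _ _ _ _ h' h h2)
  · rw [if_neg h1, if_neg h2] at he
    rw [he]

theorem surjOn_comparison (hsurj : ∀ (p : P) (n : ℕ), n < r p → ∃ q, r q = n)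
    (hno : ∀ X Z : Finset P, IsLevelSubset r X → IsLevelSubset r Z → rankOf r X + 1 < rankOf r Z →
      X.card = 1 ∨ Z.card = 1) :
    Set.SurjOn (comparison r) {t | IsOrderTriple r t.1 t.2.1 t.2.2}
      {t | IsChainTriple r t.1 t.2.1 t.2.2} := by
  rintro ⟨X, W, Z⟩ h
  change IsChainTriple r X W Z at h
  obtain ⟨hX, hZ, hlt, h⟩ := h
  obtain ⟨hA, hAr⟩ := isLevelSubset_level (level_nonempty hsurj hZ hlt)
  have hself : ∀ (_ : IsOrderTriple r X W Z) (_ : W ≠ level r (rankOf r X)), (X, W, Z) ∈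
      comparison r '' {t | IsOrderTriple r t.1 t.2.1 t.2.2} := fun h h' =>
    ⟨(X, W, Z), h, by simp [comparison, h']⟩
  have hbottom : X.card = 1 → (rankOf r X + 1 = rankOf r Z → Z.card = 1) →
      IsOrderTriple r X (level r (rankOf r X)) Z := fun h1 h2 =>
    ⟨hX, hA, hZ, hlt, Or.inr (Or.inr (Or.inr
      ⟨by rw [hAr], hAr.ge, hAr.trans_lt hlt, fun _ => h1, by rwa [hAr]⟩))⟩
  rcases h with ⟨hne, x, hx, hW⟩ | ⟨hne, z, hz, hW⟩ | ⟨hW, h1, h2⟩ | ⟨hW, h1, h2⟩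
  · have hWX : W ⊂ X := hW ▸ Finset.erase_ssubset hx
    refine hself ⟨hX, hX.subset hne hWX.1, hZ, hlt, Or.inl ⟨x, hx, hW⟩⟩ fun e => ?_
    exact hWX.2 (e ▸ hX.subset_level)
  · have hWZ : W ⊆ Z := hW ▸ Finset.erase_subset z Z
    refine hself ⟨hX, hZ.subset hne hWZ, hZ, hlt, Or.inr (Or.inl ⟨z, hz, hW⟩)⟩ fun e => ?_
    have := hZ.rankOf_eq_of_subset hne hWZ
    rw [e, hAr] at this
    omega
  · have hWA : W ≠ level r (rankOf r X) := fun e => by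
      rw [e, hAr] at h1
      exact lt_irrefl _ h1
    by_cases hfull : W = level r (rankOf r W)
    · by_cases hcard : rankOf r W + 1 = rankOf r Z → Z.card = 1
      · exact hself ⟨hX, hW, hZ, hlt, Or.inr (Or.inr (Or.inr
          ⟨hfull, h1.le, h2, fun e => absurd e h1.ne, hcard⟩))⟩ hWA
      -- Here `W` is the full level just below a non-singleton `Z`. The hypothesis makes `X` a
      -- singleton, so the triple comes from the one with the full level of `X` in the middle.
      · push Not at hcard
        refine ⟨(X, level r (rankOf r X), Z), hbottom ?_ (fun e => by omega), ?_⟩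
        · exact (hno X Z hX hZ (by omega)).resolve_right hcard.2
        · have : rankOf r Z - 1 = rankOf r W := by omega
          simp [comparison, hcard.2, this, ← hfull]
    · exact hself ⟨hX, hW, hZ, hlt, Or.inr (Or.inr (Or.inl ⟨h1, h2, hfull⟩))⟩ hWA
  · exact ⟨(X, level r (rankOf r X), Z), hbottom h1 fun _ => h2, by simp [comparison, h2, hW]⟩

/-- The missed triple has the full level just below `Z` in the middle. A preimage would have a full
level as its middle: that of `X`, forcing `X` to be a singleton, or the one below `Z`, forcing `Z`
to be one. -/
theorem not_surjOn_comparison (hsurj : ∀ (p : P) (n : ℕ), n < r p → ∃ q, r q = n)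
    {X Z : Finset P} (hX : IsLevelSubset r X) (hZ : IsLevelSubset r Z)
    (hlt : rankOf r X + 1 < rankOf r Z) (hXc : X.card ≠ 1) (hZc : Z.card ≠ 1) :
    ∃ t, IsChainTriple r t.1 t.2.1 t.2.2 ∧
      t ∉ comparison r '' {t | IsOrderTriple r t.1 t.2.1 t.2.2} := by
  obtain ⟨hA, hAr⟩ := isLevelSubset_level
    (level_nonempty hsurj hZ (n := rankOf r Z - 1) (by omega))
  refine ⟨(X, level r (rankOf r Z - 1), Z),
    ⟨hX, hZ, by dsimp only; omega, Or.inr (Or.inr (Or.inl ⟨hA, ?_, ?_⟩))⟩, ?_⟩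
  · dsimp only
    omega
  · dsimp only
    omega
  · rintro ⟨⟨X', W, Z'⟩, h, he⟩
    simp only [comparison, Prod.mk.injEq] at he
    obtain ⟨rfl, he, rfl⟩ := he
    change IsOrderTriple r X' W Z' at h
    split_ifs at he with h1
    · exact hXc ((h.of_eq_level h1).2.2.2.1 rfl)
    · exact hZc ((h.of_eq_level he).2.2.2.2 (by omega))

end Comparison

/-! ### X-posets in terms of levels, and the conclusion -/

theorem containsXPoset_iff {P : Type*} [PartialOrder P] {r : P → ℕ}
    (hr : ∀ p q : P, p < q ↔ r p < r q)
    (hsurj : ∀ (p : P) (n : ℕ), n < r p → ∃ q, r q = n) :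
    ContainsXPoset P ↔ ∃ X Z : Finset P, IsLevelSubset r X ∧ IsLevelSubset r Z ∧
      rankOf r X + 1 < rankOf r Z ∧ X.card ≠ 1 ∧ Z.card ≠ 1 := by
  classical
  have hinc : ∀ a b, (¬ a ≤ b ∧ ¬ b ≤ a) → r a = r b ∧ a ≠ b := fun a b h =>
    ⟨le_antisymm (not_lt.1 fun h' => h.2 ((hr _ _).2 h').le)
      (not_lt.1 fun h' => h.1 ((hr _ _).2 h').le), fun e => h.1 e.le⟩
  have hinc' : ∀ a b, r a = r b → a ≠ b → (¬ a ≤ b ∧ ¬ b ≤ a) := fun a b h hne =>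
    ⟨fun h' => ((hr _ _).1 (lt_of_le_of_ne h' hne)).ne h,
      fun h' => ((hr _ _).1 (lt_of_le_of_ne h' hne.symm)).ne h.symm⟩
  have htwo : ∀ X : Finset P, IsLevelSubset r X → X.card ≠ 1 → ∃ a ∈ X, ∃ b ∈ X, a ≠ b := by
    intro X hX hc
    have := hX.1.card_pos
    obtain ⟨a, ha, b, hb, hab⟩ := Finset.one_lt_card.1 (show 1 < X.card by omega)
    exact ⟨a, ha, b, hb, hab⟩
  constructor
  · rintro ⟨a, b, c, d, e, hac, -, hcd, -, hab, hde⟩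
    obtain ⟨hab, hab'⟩ := hinc _ _ hab
    obtain ⟨hde, hde'⟩ := hinc _ _ hde
    have h1 : ∀ p ∈ ({a, b} : Finset P), r p = r a := by simp [hab]
    have h2 : ∀ p ∈ ({d, e} : Finset P), r p = r d := by simp [hde]
    have h3 := (hr _ _).1 hac
    have h4 := (hr _ _).1 hcd
    refine ⟨{a, b}, {d, e}, isLevelSubset_of (by simp) h1, isLevelSubset_of (by simp) h2, ?_, ?_, ?_⟩
    · rw [rankOf_eq (by simp) h1, rankOf_eq (by simp) h2]
      omega
    · simp [Finset.card_pair hab']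
    · simp [Finset.card_pair hde']
  · rintro ⟨X, Z, hX, hZ, hlt, hXc, hZc⟩
    obtain ⟨a, ha, b, hb, hab⟩ := htwo X hX hXc
    obtain ⟨d, hd, e, he, hde⟩ := htwo Z hZ hZc
    have ra := hX.2 a ha
    have rb := hX.2 b hb
    have rd := hZ.2 d hd
    have re := hZ.2 e he
    -- Any element of the level just above `X` serves as the centre of the X-poset.
    obtain ⟨c, hc⟩ := hsurj d (rankOf r X + 1) (by omega)
    exact ⟨a, b, c, d, e, (hr _ _).2 (by omega), (hr _ _).2 (by omega), (hr _ _).2 (by omega),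
      (hr _ _).2 (by omega), hinc' a b (by omega) hab, hinc' d e (by omega) hde⟩

theorem mainTheorem2 (P : Type*) [PartialOrder P] [Finite P] (hP : IsMaximalRanked P) :
    ((triangularFaces (orderPolytope P)).encard = (triangularFaces (chainPolytope P)).encard ↔
      ¬ ContainsXPoset P) ∧
    (ContainsXPoset P →
      (triangularFaces (orderPolytope P)).encard < (triangularFaces (chainPolytope P)).encard) := by
  classical
  cases nonempty_fintype P
  obtain ⟨r, hr, hsurj⟩ := hP.exists_rank
  rw [orderPolytope_eq_convexHull, chainPolytope_eq_convexHull hr, encard_triangularFaces,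
    encard_triangularFaces, encard_faceFamilies_lowerSets hr hsurj,
    encard_faceFamilies_antichains hr, ← (injOn_comparison (r := r)).encard_image]
  have hlt : ContainsXPoset P →
      (comparison r '' {t | IsOrderTriple r t.1 t.2.1 t.2.2}).encard <
        {t : Finset P × Finset P × Finset P | IsChainTriple r t.1 t.2.1 t.2.2}.encard := by
    intro hcon
    obtain ⟨X, Z, hX, hZ, hlt, hXc, hZc⟩ := (containsXPoset_iff hr hsurj).1 hcon
    obtain ⟨t, ht, ht'⟩ := not_surjOn_comparison hsurj hX hZ hlt hXc hZc
    -- Finiteness turns the strict inclusion of the image into a strict inequality of cardinalities.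
    exact (Set.toFinite _).encard_lt_encard
      ⟨(mapsTo_comparison hsurj).image_subset, fun h => ht' (h ht)⟩
  refine ⟨⟨fun he hcon => (hlt hcon).ne he, fun hcon => ?_⟩, hlt⟩
  congr 1
  refine (mapsTo_comparison hsurj).image_subset.antisymm (surjOn_comparison hsurj ?_)
  intro X Z hX hZ hXZ
  by_contra h
  push Not at h
  exact hcon ((containsXPoset_iff hr hsurj).2 ⟨X, Z, hX, hZ, hXZ, h.1, h.2⟩)
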